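/- Let $H$ be a finite-dimensional Hopf algebra over a field $k$, with multiplication $m$, comultiplication $\Delta$, counit $\varepsilon$ and antipode $S$ (which is bijective, since $\dim H<\infty$). Let $m_n:H^{\otimes n}\to H$ and $\Delta_n:H\to H^{\otimes n}$ be the iterated product and coproduct ($m_1=\Delta_1=I$ is the identity map, $m_n=m\circ(m_{n-1}\otimes I)$, $\Delta_n=(\Delta_{n-1}\otimes I)\circ\Delta$). The exponent $\exp(H)$ is the smallest positive integer $n$ with $$m_n\circ(I\otimes S^{-2}\otimes\cdots\otimes S^{-2n+2})\circ\Delta_n=\varepsilon\cdot 1,$$ and $\exp(H)=\infty$ if there is no such $n$. Let $D(H)=H^{*\mathrm{cop}}\otimes H$ be the Drinfeld double of $H$: as a coalgebra it is the tensor product of $H^{*\mathrm{cop}}$ and $H$, its product is $$(p\otimes h)(q\otimes g)=\sum p\cdot q\big(S^{-1}(h_{(3)})\,?\,h_{(1)}\big)\otimes h_{(2)}g$$ (where $H^*$ has the convolution product), its unit is $\varepsilon\otimes 1$, and its antipode, again denoted $S$, is $S(p\otimes h)=(\varepsilon\otimes S(h))\,((p\circ S^{-1})\otimes 1)$. Identify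 $h\in H$ with $\varepsilon\otimes h$ and $p\in H^*$ with $p\otimes 1$. Let $\mathcal R=\sum_i h_i\otimes h_i^*\in D(H)\otimes D(H)$ be the universal $R$-matrix, where $\{h_i\}$, $\{h_i^*\}$ are dual bases of $H$ and $H^*$, let $\mathcal R_{21}$ be its image under the flip, and let $u=\sum_i S(h_i^*)h_i\in D(H)$ be the Drinfeld element. The order of an element $x$ of an algebra is the smallest positive integer $n$ with $x^n=1$, or $\infty$ if there is none. Then: 1. $\exp(H)$ equals the smallest positive integer $n$ such that $$\mathcal R\,(I\otimes S^2)(\mathcal R)\cdots(I\otimes S^{2n-2})(\mathcal R)=1$$ in $D(H)\otimes D(H)$ (and $\exp(H)=\infty$ if there is no such $n$). 2. $\exp(H)$ equals the order of $u$. 3. $\exp(H)$ equals the order of $\mathcal R_{21}\mathcal R$. 4. $\mathcal R_{21}\mathcal R$ is invertible, and $\exp(H)$ equals the order of every non-zero element $v\in D(H)$ satisfying $\Delta(v)=(v\otimes v)(\mathcal R_{21}\mathcal R)^{-1}$. -/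

import Mathlib

open scoped TensorProduct

namespace FinHopf

open Coalgebra WithConv HopfAlgebra

variable {k H : Type*} [Field k] [Ring H] [HopfAlgebra k H]
open Algebra.TensorProduct

theorem incl_inv {B : Type*} [Ring B] [Algebra k B] (f : H →ₐ[k] B) :
    toConv f.toLinearMap * toConv (f.toLinearMap ∘ₗ antipode k) = 1 := by
  have := LinearMap.algHom_comp_convMul_distrib (R := k) f (toConv (LinearMap.id : H →ₗ[k] H)) (toConv (antipode k))
  apply WithConv.ofConv_injective
  rw [LinearMap.id_mul_antipode] at this
  have h2 := this.symm
  simp only [LinearMap.comp_id] at h2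
  rw [h2]; ext; simp

theorem inv_incl {B : Type*} [Ring B] [Algebra k B] (f : H →ₐ[k] B) :
    toConv (f.toLinearMap ∘ₗ antipode k) * toConv f.toLinearMap = 1 := by
  have := LinearMap.algHom_comp_convMul_distrib (R := k) f (toConv (antipode k)) (toConv (LinearMap.id : H →ₗ[k] H)) 
  apply WithConv.ofConv_injective
  rw [LinearMap.antipode_mul_id] at this
  have h2 := this.symm
  simp only [LinearMap.comp_id] at h2
  rw [h2]; ext; simp

theorem comul_eq : toConv (comul : H →ₗ[k] H ⊗[k] H) =
    toConv (includeLeft (R := k) (S := k) (A := H) (B := H)).toLinearMap * toConv (includeRight (R := k) (A := H) (B := H)).toLinearMap := by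
  ext h
  rw [(ℛ k h).convMul_apply]
  simp [(ℛ k h).eq]

theorem comul_antipode_conv : toConv (comul ∘ₗ antipode k : H →ₗ[k] H ⊗[k] H) =
    toConv ((includeRight (R := k) (A := H) (B := H)).toLinearMap ∘ₗ antipode k) *
    toConv ((includeLeft (R := k) (S := k) (A := H) (B := H)).toLinearMap ∘ₗ antipode k) := by
  have h1 := LinearMap.comul_right_inv (R := k) (C := H)
  rw [comul_eq] at h1
  have h2 := inv_incl (k := k) (includeRight (R := k) (A := H) (B := H))
  have h3 := inv_incl (k := k) (includeLeft (R := k) (S := k) (A := H) (B := H))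
  refine (left_inv_eq_right_inv ?_ h1).symm
  rw [mul_assoc, ← mul_assoc _ _ (toConv includeRight.toLinearMap), h3, one_mul, h2]

theorem comul_antipode (h : H) : comul (R := k) (antipode k h) =
    TensorProduct.map (antipode k) (antipode k) (TensorProduct.comm k H H (comul h)) := by
  have := congr($(comul_antipode_conv (k := k) (H := H)) h)
  rw [(ℛ k h).convMul_apply] at this
  simp only [LinearMap.comp_apply] at this
  rw [this]
  conv_rhs => rw [← (ℛ k h).eq]
  simp

theorem comul_antipode_mul {ι : Type*} (h : H) (r : Coalgebra.Repr k h ι) :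
  ∑ i ∈ r.index, comul (R := k) (antipode k (r.left i)) * (r.right i ⊗ₜ[k] (1:H)) = 1 ⊗ₜ antipode k h := by
  have h1 : toConv (comul ∘ₗ antipode k : H →ₗ[k] H ⊗[k] H) * toConv (includeLeft (R := k) (S := k) (A := H) (B := H)).toLinearMap = toConv ((includeRight (R := k) (A := H) (B := H)).toLinearMap ∘ₗ antipode k) := by
    rw [comul_antipode_conv, mul_assoc, inv_incl, mul_one]
  have := congr($h1 h)
  rw [r.convMul_apply] at this
  simpa using this

/-- `x ↦ x₁ f(x₂)` -/
noncomputable def hit (f : H →ₗ[k] k) : H →ₗ[k] H :=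
  (TensorProduct.rid k H).toLinearMap ∘ₗ f.lTensor H ∘ₗ comul

theorem hit_repr {ι : Type*} (f : H →ₗ[k] k) (h : H) (r : Coalgebra.Repr k h ι) :
    hit f h = ∑ i ∈ r.index, f (r.right i) • r.left i := by
  simp [hit, ← r.eq]

theorem lTensor_hit_comul (f : H →ₗ[k] k) (h : H) :
    (hit f).lTensor H (comul h) = comul (R := k) (hit f h) := by
  have h1 : (hit f).lTensor H (comul h) =
      ((TensorProduct.rid k H).toLinearMap ∘ₗ f.lTensor H).lTensor H
        (TensorProduct.assoc k H H H (comul.rTensor H (comul h))) := by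
    rw [Coalgebra.coassoc_apply, ← LinearMap.lTensor_comp_apply]
    rfl
  rw [h1]
  simp only [hit, LinearMap.comp_apply]
  generalize comul (R := k) h = t
  induction t with
  | zero => simp
  | tmul x y =>
    simp only [LinearMap.rTensor_tmul, LinearMap.lTensor_tmul, LinearEquiv.coe_coe,
      TensorProduct.rid_tmul, map_smul]
    generalize comul (R := k) x = s
    induction s with
    | zero => simp
    | tmul a b => simp
    | add a b ha hb => simp only [map_add, TensorProduct.add_tmul, smul_add, ha, hb]
  | add a b ha hb => simp only [map_add, ha, hb]

theorem counit_hit (f : H →ₗ[k] k) (h : H) : counit (R := k) (hit f h) = f h := by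
  rw [hit_repr f h (ℛ k h)]
  have := congr(f $(Coalgebra.sum_counit_smul (ℛ k h)))
  rw [← this]; simp [mul_comm]

theorem hit_mul_antipode {ι : Type*} (f : H →ₗ[k] k) (x h : H) (r : Coalgebra.Repr k h ι) :
    ∑ i ∈ r.index, hit f (x * antipode k (r.left i)) * r.right i =
      TensorProduct.rid k H (f.lTensor H (comul (R := k) x * (1 ⊗ₜ antipode k h))) := by
  rw [← comul_antipode_mul h r, Finset.mul_sum, map_sum, map_sum]
  refine Finset.sum_congr rfl fun i _ => ?_
  rw [← mul_assoc, ← Bialgebra.comul_mul]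
  simp only [hit, LinearMap.comp_apply]
  generalize comul (R := k) (x * antipode k (r.left i)) = t
  induction t with
  | zero => simp
  | tmul a b => simp
  | add a b ha hb => simp only [map_add, add_mul, ← ha, ← hb]

theorem comul_basis {ι : Type*} [Fintype ι] (b : Module.Basis ι k H) (h : H) :
    comul (R := k) h = ∑ j, hit (b.coord j) h ⊗ₜ[k] b j := by
  simp only [hit, LinearMap.comp_apply]
  generalize comul (R := k) h = t
  induction t with
  | zero => simp
  | tmul x y => 
    simp only [LinearMap.lTensor_tmul, LinearEquiv.coe_coe, TensorProduct.rid_tmul, TensorProduct.smul_tmul, ← TensorProduct.tmul_sum]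
    simp [Module.Basis.sum_repr]
  | add a b ha hb => simp only [map_add, TensorProduct.add_tmul, Finset.sum_add_distrib, ← ha, ← hb]

/-- The expansion of `Δ(h)` along a basis in the second factor. -/
noncomputable def reprBasis {ι : Type} [Fintype ι] (b : Module.Basis ι k H) (h : H) : Coalgebra.Repr k h ι where
  index := Finset.univ
  left j := hit (b.coord j) h
  right j := b j
  eq := (comul_basis b h).symm


theorem sum_hit_mul_antipode {ι : Type} [Fintype ι] (b : Module.Basis ι k H) (ψ : H →ₗ[k] k) (w : H) :
    ∑ i, hit (b.coord i) w * antipode k (hit ψ (b i)) = algebraMap k H (ψ w) := by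
  have h1 := mul_antipode_lTensor_comul_apply (R := k) (hit ψ w)
  rw [counit_hit, ← lTensor_hit_comul, comul_basis b w] at h1
  simpa using h1

/-- An integral on `H` built from `f`: `x ↦ tr(z ↦ (x S²(z))₁ f((x S²(z))₂))`. -/
noncomputable def integralOf {ι : Type} [Fintype ι] (b : Module.Basis ι k H) (f : H →ₗ[k] k) : H →ₗ[k] k :=
  ∑ i, (b.coord i ∘ₗ hit f) ∘ₗ LinearMap.mulRight k (antipode k (antipode k (b i)))

theorem hit_coord_hit (g f : H →ₗ[k] k) (y : H) : hit (g ∘ₗ hit f) y = hit g (hit f y) := by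
  have h1 : hit (g ∘ₗ hit f) y = TensorProduct.rid k H (g.lTensor H ((hit f).lTensor H (comul y))) := by
    rw [← LinearMap.comp_apply (LinearMap.lTensor H g), ← LinearMap.lTensor_comp]; rfl
  rw [h1, lTensor_hit_comul]; rfl

theorem hit_integralOf {ι : Type} [Fintype ι] (b : Module.Basis ι k H) (f : H →ₗ[k] k) (x : H) :
    hit (integralOf b f) x = algebraMap k H (integralOf b f x) := by
  have key : ∀ i, hit ((b.coord i ∘ₗ hit f) ∘ₗ LinearMap.mulRight k (antipode k (antipode k (b i)))) x
      = ∑ j, hit (b.coord i) (hit f (x * antipode k (antipode k (b j)))) *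
        antipode k (hit (b.coord j) (b i)) := by
    intro i
    let r : Coalgebra.Repr k (antipode k (b i)) ι :=
      { index := Finset.univ
        left := fun j => antipode k (b j)
        right := fun j => antipode k (hit (b.coord j) (b i))
        eq := by
          rw [comul_antipode, comul_basis b (b i)]
          simp }
    have h1 := hit_mul_antipode (b.coord i ∘ₗ hit f) x (antipode k (b i)) r
    simp only [hit_coord_hit] at h1
    change ∑ j, _ = _ at h1
    refine Eq.trans ?_ h1.symm
    simp only [hit, LinearMap.comp_apply]
    generalize comul (R := k) x = t
    induction t with
    | zero => simp
    | tmul a c => simp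
    | add a c ha hc => simp only [map_add, add_mul, ← ha, ← hc]
  have h2 : hit (integralOf b f) x = ∑ i, hit ((b.coord i ∘ₗ hit f) ∘ₗ LinearMap.mulRight k (antipode k (antipode k (b i)))) x := by
    simp only [integralOf, hit, LinearMap.comp_apply]
    generalize comul (R := k) x = t
    induction t with
    | zero => simp
    | tmul a c => simp [Finset.sum_smul]
    | add a c ha hc => simp only [map_add, Finset.sum_add_distrib, ← ha, ← hc]
  rw [h2]
  simp only [key]
  rw [Finset.sum_comm]
  simp only [sum_hit_mul_antipode]
  simp [integralOf]

theorem exists_integralOf_ne_zero {ι : Type} [Fintype ι] (b : Module.Basis ι k H) :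
    ∃ f x, integralOf b f x ≠ 0 := by
  by_contra! hz
  classical
  let M : H ⊗[k] H →ₗ[k] H := antipode k ∘ₗ LinearMap.mul' k H ∘ₗ (antipode k).rTensor H
  have := Module.Finite.of_basis b
  have t1 : LinearMap.trace k _ ((comul : H →ₗ[k] H ⊗[k] H) ∘ₗ M) = LinearMap.trace k _ (M ∘ₗ comul) :=
    LinearMap.trace_comp_comm' _ _
  have hM : M ∘ₗ comul = Algebra.linearMap k H ∘ₗ counit := by
    simp only [M, LinearMap.comp_assoc]
    rw [mul_antipode_rTensor_comul]
    ext; simp [Algebra.algebraMap_eq_smul_one]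
  have t2 : LinearMap.trace k _ (M ∘ₗ comul) = 1 := by
    rw [hM, LinearMap.trace_comp_comm']
    have : (counit ∘ₗ Algebra.linearMap k H : k →ₗ[k] k) = LinearMap.id := by ext; simp
    rw [this]; simp
  rw [t2, LinearMap.trace_eq_matrix_trace k (b.tensorProduct b), Matrix.trace, Fintype.sum_prod_type, Finset.sum_comm] at t1
  have t3 : ∀ a, ∑ i, ((LinearMap.toMatrix (b.tensorProduct b) (b.tensorProduct b)) (comul ∘ₗ M)).diag (i, a) = integralOf b (b.coord a) (antipode k (b a)) := by
    intro a
    simp only [integralOf, LinearMap.sum_apply]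
    refine Finset.sum_congr rfl fun i _ => ?_
    simp only [Matrix.diag_apply, LinearMap.toMatrix_apply, Module.Basis.tensorProduct_apply, LinearMap.comp_apply, M, LinearMap.rTensor_tmul, LinearMap.mul'_apply, LinearMap.mulRight_apply, ← antipode_mul_antidistrib, hit]
    generalize comul (R := k) (antipode k (antipode k (b i) * b a)) = t
    induction t with
    | zero => simp
    | tmul x y => simp [mul_comm]
    | add x y hx hy => simp only [map_add, ← hx, ← hy, Finsupp.add_apply]
  have t4 := fun a => (t3 a).trans (hz _ _)
  rw [Finset.sum_eq_zero fun a _ => t4 a] at t1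
  exact zero_ne_one t1

theorem antipode_injective [FiniteDimensional k H] : Function.Injective (antipode k (A := H)) := by
  rw [← LinearMap.ker_eq_bot, LinearMap.ker_eq_bot']
  intro h hh
  let b := Module.finBasis k H
  obtain ⟨f, x, hx⟩ := exists_integralOf_ne_zero b
  set l := integralOf b f with hl
  have hint : ∀ x, hit l x = algebraMap k H (l x) := hit_integralOf b f
  have h1 : ∀ y j, l (y * antipode k (hit (b.coord j) h)) = 0 := by
    intro y
    have := hit_mul_antipode l y h (reprBasis b h)
    simp only [hh, TensorProduct.tmul_zero, mul_zero, map_zero, hint, ← Algebra.smul_def] at this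
    exact fun j => Fintype.linearIndependent_iff.1 b.linearIndependent _ this j
  have h2 : l x • h = 0 := by
    have e1 : comul.lTensor H (comul (R := k) h) = ∑ j, hit (b.coord j) h ⊗ₜ[k] comul (R := k) (b j) := by
      rw [comul_basis b h]; simp
    let P : H ⊗[k] H →ₗ[k] k := l ∘ₗ LinearMap.mulLeft k x ∘ₗ antipode k ∘ₗ LinearMap.mul' k H ∘ₗ
      (antipode k).lTensor H
    let V : (H ⊗[k] H) ⊗[k] H →ₗ[k] H := (TensorProduct.lid k H).toLinearMap ∘ₗ P.rTensor H
    have hP : P ∘ₗ comul = l x • counit := by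
      simp only [P, LinearMap.comp_assoc]
      rw [mul_antipode_lTensor_comul]
      ext z
      simp [Algebra.algebraMap_eq_smul_one, mul_comm]
    have e2 : V (comul.rTensor H (comul (R := k) h)) = l x • h := by
      simp only [V, LinearMap.comp_apply]
      rw [← LinearMap.comp_apply (LinearMap.rTensor H P), ← LinearMap.rTensor_comp, hP,
        LinearMap.rTensor_smul, LinearMap.smul_apply, Coalgebra.rTensor_counit_comul]
      simp
    rw [← e2, ← Coalgebra.coassoc_symm_apply, e1, map_sum, map_sum]
    refine Finset.sum_eq_zero fun j _ => ?_
    generalize comul (R := k) (b j) = t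
    induction t with
    | zero => simp
    | tmul c d =>
      simp [V, P, antipode_mul_antidistrib, ← mul_assoc, h1]
    | add c d hc hd => simp only [TensorProduct.tmul_add, map_add, hc, hd, add_zero]
  exact (smul_eq_zero.1 h2).resolve_left hx

variable (k H) in
/-- The antipode of a finite-dimensional Hopf algebra, as a linear automorphism. -/
noncomputable def antipodeEquiv [FiniteDimensional k H] : H ≃ₗ[k] H :=
  LinearEquiv.ofInjectiveEndo (antipode k) antipode_injective

variable (k H) in
/-- The inverse `S⁻¹` of the antipode of a finite-dimensional Hopf algebra. -/
noncomputable def antipodeInv [FiniteDimensional k H] : H →ₗ[k] H :=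
  (antipodeEquiv k H).symm.toLinearMap

section FiniteDim
variable [FiniteDimensional k H]

theorem antipode_antipodeInv (x : H) : antipode k (antipodeInv k H x) = x :=
  (antipodeEquiv k H).apply_symm_apply x

theorem antipodeInv_antipode (x : H) : antipodeInv k H (antipode k x) = x :=
  (antipodeEquiv k H).symm_apply_apply x

theorem antipodeInv_mul (x y : H) :
    antipodeInv k H (x * y) = antipodeInv k H y * antipodeInv k H x := by
  apply antipode_injective (k := k)
  simp [antipode_mul_antidistrib, antipode_antipodeInv]

theorem antipodeInv_one : antipodeInv k H 1 = 1 := by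
  apply antipode_injective (k := k)
  simp [antipode_antipodeInv]

theorem counit_antipodeInv (x : H) : counit (R := k) (antipodeInv k H x) = counit x := by
  rw [← counit_antipode, antipode_antipodeInv]

theorem comul_antipodeInv (x : H) : comul (R := k) (antipodeInv k H x) =
    TensorProduct.map (antipodeInv k H) (antipodeInv k H) (TensorProduct.comm k H H (comul x)) := by
  conv_rhs => rw [← antipode_antipodeInv (k := k) x, comul_antipode]
  generalize comul (R := k) (antipodeInv k H x) = t
  induction t with
  | zero => simp
  | tmul a b => simp [antipodeInv_antipode]
  | add a b ha hb => simp only [map_add, ← ha, ← hb]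
end FiniteDim

variable (k H) in
/-- The dual space with the convolution product `(p * q)(x) = ∑ p(x₁) q(x₂)`. -/
abbrev ConvDual := WithConv (H →ₗ[k] k)

variable (k H) in
/-- The underlying space `H^* ⊗ H` of the Drinfeld double `D(H)`. It carries the multiplication
of the double (below), which is not that of the tensor product algebra. -/
def DrinfeldDouble : Type _ := ConvDual k H ⊗[k] H

namespace DrinfeldDouble
noncomputable instance : AddCommGroup (DrinfeldDouble k H) := inferInstanceAs (AddCommGroup (ConvDual k H ⊗[k] H))
noncomputable instance : Module k (DrinfeldDouble k H) := inferInstanceAs (Module k (ConvDual k H ⊗[k] H))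

variable (k H) in
/-- The identification of `H^* ⊗ H` with the underlying space of `D(H)`. -/
def of : ConvDual k H ⊗[k] H ≃ₗ[k] DrinfeldDouble k H := LinearEquiv.refl k (ConvDual k H ⊗[k] H)

end DrinfeldDouble

/-- The iterated coproduct `h ↦ ∑ h₁ ⊗ h₂ ⊗ h₃`. -/
noncomputable def comul₃ : H →ₗ[k] H ⊗[k] (H ⊗[k] H) := comul.lTensor H ∘ₗ comul

theorem comul₃_mul (h g : H) : comul₃ (k := k) (h * g) = comul₃ h * comul₃ g := by
  simp only [comul₃, LinearMap.comp_apply, Bialgebra.comul_mul]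
  exact map_mul (Algebra.TensorProduct.map (AlgHom.id k H) (Bialgebra.comulAlgHom k H)) _ _


variable (k H) in
/-- Rebracketing of a fivefold tensor product. -/
noncomputable def ee : (H ⊗[k] H) ⊗[k] (H ⊗[k] (H ⊗[k] H)) ≃ₗ[k] H ⊗[k] ((H ⊗[k] (H ⊗[k] H)) ⊗[k] H) :=
  TensorProduct.assoc k H H _ ≪≫ₗ LinearEquiv.lTensor H 
   (LinearEquiv.lTensor H (TensorProduct.assoc k H H H).symm ≪≫ₗ (TensorProduct.assoc k H _ H).symm)

theorem nest : ((ee k H).toLinearMap ∘ₗ TensorProduct.map (comul (R := k) (A := H)) (TensorProduct.map LinearMap.id comul)) ∘ₗ comul₃ 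
   = TensorProduct.map LinearMap.id (TensorProduct.map comul₃ LinearMap.id) ∘ₗ comul₃ := by
  simp only [ee, comul₃]
  simp only [coassoc_simps]

theorem ee_tmul (a a' b c c' : H) :
    ee k H ((a ⊗ₜ a') ⊗ₜ (b ⊗ₜ (c ⊗ₜ c'))) = a ⊗ₜ ((a' ⊗ₜ (b ⊗ₜ c)) ⊗ₜ c') := rfl

/-- The linear map `p ↦ p ∘ f` on the dual. -/
noncomputable def precomp (f : H →ₗ[k] H) : ConvDual k H →ₗ[k] ConvDual k H :=
  (WithConv.linearEquiv k (H →ₗ[k] k)).symm.toLinearMap ∘ₗ LinearMap.lcomp k k f ∘ₗ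
  (WithConv.linearEquiv k (H →ₗ[k] k)).toLinearMap

section FiniteDim
variable [FiniteDimensional k H]

variable (k H) in
/-- The comultiplication `p ↦ ∑ p₂ ⊗ p₁` of `H^{*cop}`, where `p(xy) = ∑ p₁(x) p₂(y)`. -/
noncomputable def dualComulCop : ConvDual k H →ₗ[k] ConvDual k H ⊗[k] ConvDual k H :=
  TensorProduct.map (WithConv.linearEquiv k (H →ₗ[k] k)).symm.toLinearMap
    (WithConv.linearEquiv k (H →ₗ[k] k)).symm.toLinearMap ∘ₗ
  (TensorProduct.comm k (H →ₗ[k] k) (H →ₗ[k] k)).toLinearMap ∘ₗ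
  (TensorProduct.dualDistribEquiv k H H).symm.toLinearMap ∘ₗ
  LinearMap.lcomp k k (LinearMap.mul' k H) ∘ₗ
  (WithConv.linearEquiv k (H →ₗ[k] k)).toLinearMap

variable (k H) in
/-- The functional `p(S⁻¹(c) ? a) : x ↦ p(S⁻¹(c) x a)`, as a trilinear map. -/
noncomputable def sandwich : H →ₗ[k] H →ₗ[k] ConvDual k H →ₗ[k] ConvDual k H :=
  LinearMap.mk₂ k
    (fun a c =>
      { toFun := fun p => toConv (p.ofConv ∘ₗ LinearMap.mulRight k a ∘ₗ LinearMap.mulLeft k (antipodeInv k H c))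
        map_add' := fun p q => by ext; simp
        map_smul' := fun r p => by ext; simp })
    (fun a a' c => by ext p x; simp [mul_add])
    (fun r a c => by ext p x; simp)
    (fun a c c' => by ext p x; simp [add_mul])
    (fun r a c => by ext p x; simp)

@[simp] theorem sandwich_apply (a c : H) (p : ConvDual k H) (x : H) :
    sandwich k H a c p x = p (antipodeInv k H c * x * a) := rfl

variable (k H) in
/-- `a ⊗ b ⊗ c, p ↦ p(S⁻¹(c) ? a) ⊗ b` -/
noncomputable def straightenAux : H ⊗[k] (H ⊗[k] H) →ₗ[k] ConvDual k H →ₗ[k] ConvDual k H ⊗[k] H :=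
  TensorProduct.lift
    { toFun := fun a => TensorProduct.lift (LinearMap.mk₂ k
        (fun b c => (TensorProduct.mk k (ConvDual k H) H).flip b ∘ₗ sandwich k H a c)
        (fun b b' c => by ext p; simp)
        (fun r b c => by ext p; simp)
        (fun b c c' => by ext p; simp)
        (fun r b c => by ext p; simp [TensorProduct.smul_tmul']))
      map_add' := fun a a' => by ext b c p; simp
      map_smul' := fun r a => by ext b c p; simp [TensorProduct.smul_tmul'] }

@[simp] theorem straightenAux_tmul (a b c : H) (p : ConvDual k H) :
    straightenAux k H (a ⊗ₜ (b ⊗ₜ c)) p = sandwich k H a c p ⊗ₜ b := rfl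

variable (k H) in
/-- The exchange rule of the double: `h, p ↦ ∑ p(S⁻¹(h₃) ? h₁) ⊗ h₂`, which is the
product `(1 ⊗ h) * (p ⊗ 1)` in `D(H)`. -/
noncomputable def straighten : H →ₗ[k] ConvDual k H →ₗ[k] ConvDual k H ⊗[k] H :=
  straightenAux k H ∘ₗ comul₃

theorem straighten_one (p : ConvDual k H) : straighten k H 1 p = p ⊗ₜ 1 := by
  simp only [straighten, comul₃, LinearMap.comp_apply, Bialgebra.comul_one, Algebra.TensorProduct.one_def, LinearMap.lTensor_tmul, straightenAux_tmul]
  congr 1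
  ext x
  simp [antipodeInv_one]

theorem straighten_unit (h : H) : straighten k H h 1 = 1 ⊗ₜ h := by
  have h1 : ∀ t : H ⊗[k] (H ⊗[k] H), straightenAux k H t 1 = 1 ⊗ₜ
     (TensorProduct.lid k H (counit.rTensor H (TensorProduct.rid k H |>.toLinearMap.lTensor H ((counit.lTensor H).lTensor H t)))) := by
    intro t
    induction t with
    | zero => simp
    | add a b ha hb => simp only [map_add, LinearMap.add_apply, TensorProduct.tmul_add, ha, hb]
    | tmul a s =>
      induction s with
      | zero => simp
      | add c d hc hd => simp only [TensorProduct.tmul_add, map_add, LinearMap.add_apply, hc, hd]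
      | tmul b c =>
        simp only [straightenAux_tmul, LinearMap.lTensor_tmul, LinearEquiv.coe_coe, TensorProduct.rid_tmul, LinearMap.rTensor_tmul, TensorProduct.lid_tmul, TensorProduct.tmul_smul, TensorProduct.smul_tmul']
        congr 1
        ext x
        simp [counit_antipodeInv]
        ring
  simp only [straighten, LinearMap.comp_apply, h1]
  congr 1
  simp only [comul₃, LinearMap.comp_apply, ← LinearMap.lTensor_comp_apply]
  simp [Coalgebra.lTensor_counit_comp_comul]
  have : ((TensorProduct.rid k H).toLinearMap ∘ₗ ((TensorProduct.mk k H k).flip 1)) = LinearMap.id := by ext; simp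
  simp [this]

theorem straighten_mul (h g : H) (p : ConvDual k H) :
    straighten k H (h * g) p = (LinearMap.mul' k H).lTensor _
      (TensorProduct.assoc k _ H H ((straighten k H h).rTensor H (straighten k H g p))) := by
  have key : ∀ s t : H ⊗[k] (H ⊗[k] H), straightenAux k H (s * t) p = (LinearMap.mul' k H).lTensor _
      (TensorProduct.assoc k _ H H ((straightenAux k H s).rTensor H (straightenAux k H t p))) := by
    intro s t
    induction s with
    | zero => simp
    | add s s' hs hs' => simp only [add_mul, map_add, LinearMap.add_apply, LinearMap.rTensor_add, hs, hs']
    | tmul a s =>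
    induction s with
    | zero => simp
    | add s s' hs hs' => simp only [TensorProduct.tmul_add, add_mul, map_add, LinearMap.add_apply, LinearMap.rTensor_add, hs, hs']
    | tmul b c =>
    induction t with
    | zero => simp
    | add s s' hs hs' => simp only [mul_add, map_add, LinearMap.add_apply, hs, hs']
    | tmul a' s =>
    induction s with
    | zero => simp
    | add s s' hs hs' => simp only [TensorProduct.tmul_add, mul_add, map_add, LinearMap.add_apply, hs, hs']
    | tmul b' c' =>
      simp only [Algebra.TensorProduct.tmul_mul_tmul, straightenAux_tmul, LinearMap.rTensor_tmul, TensorProduct.assoc_tmul, LinearMap.lTensor_tmul, LinearMap.mul'_apply]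
      congr 1
      ext x
      simp [antipodeInv_mul, mul_assoc]
  simp only [straighten, LinearMap.comp_apply, comul₃_mul, key]

/-- `a ⊗ (s ⊗ c) ↦ ∑ p(S⁻¹(c) ? a) q(S⁻¹(s₃) ? s₁) ⊗ s₂`. -/
noncomputable def ww (p q : ConvDual k H) : H ⊗[k] ((H ⊗[k] (H ⊗[k] H)) ⊗[k] H) →ₗ[k] ConvDual k H ⊗[k] H :=
  (LinearMap.mul' k (ConvDual k H)).rTensor H ∘ₗ (TensorProduct.assoc k _ _ H).symm.toLinearMap ∘ₗ
   TensorProduct.map ((TensorProduct.lift (sandwich k H)).flip p) ((straightenAux k H).flip q) ∘ₗ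
   (TensorProduct.assoc k H H _).symm.toLinearMap ∘ₗ (TensorProduct.comm k _ H).toLinearMap.lTensor H

theorem sandwich_mul (a c : H) (p q : ConvDual k H) {ι κ : Type*} (r : Coalgebra.Repr k a ι) (s : Coalgebra.Repr k c κ) :
    sandwich k H a c (p * q) = ∑ i ∈ r.index, ∑ j ∈ s.index,
      sandwich k H (r.left i) (s.right j) p * sandwich k H (r.right i) (s.left j) q := by
  ext x
  simp only [WithConv.ofConv_sum, LinearMap.sum_apply, (ℛ k x).convMul_apply]
  simp only [sandwich_apply, LinearMap.convMul_apply, Bialgebra.comul_mul, comul_antipodeInv]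
  conv_lhs => rw [← r.eq, ← s.eq, ← (ℛ k x).eq]
  simp only [map_sum, Finset.sum_mul, Finset.mul_sum, TensorProduct.comm_tmul, TensorProduct.map_tmul, Algebra.TensorProduct.tmul_mul_tmul, LinearMap.mul'_apply]
  exact Finset.sum_congr rfl fun _ _ => Finset.sum_comm

theorem ww_tmul (p q : ConvDual k H) (a c : H) (s : H ⊗[k] (H ⊗[k] H)) :
    ww p q (a ⊗ₜ (s ⊗ₜ c)) = (LinearMap.mul' k (ConvDual k H)).rTensor H
      ((TensorProduct.assoc k _ _ H).symm (sandwich k H a c p ⊗ₜ straightenAux k H s q)) := rfl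

theorem straighten_convMul (h : H) (p q : ConvDual k H) :
    straighten k H h (p * q) = (LinearMap.mul' k (ConvDual k H)).rTensor H
      ((TensorProduct.assoc k _ _ H).symm (((straighten k H).flip q).lTensor _ (straighten k H h p))) := by
  have h1 : ∀ t, straightenAux k H t (p * q) = ww p q (ee k H (TensorProduct.map (comul (R := k) (A := H)) (TensorProduct.map LinearMap.id comul) t)) := by
    intro t
    induction t with
    | zero => simp
    | add s s' hs hs' => simp only [map_add, LinearMap.add_apply, hs, hs']
    | tmul a s =>
    induction s with
    | zero => simp
    | add s s' hs hs' => simp only [TensorProduct.tmul_add, map_add, LinearMap.add_apply, hs, hs']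
    | tmul b c =>
      rw [straightenAux_tmul, sandwich_mul a c p q (ℛ k a) (ℛ k c)]
      simp only [TensorProduct.map_tmul, LinearMap.id_apply]
      conv_rhs => rw [← (ℛ k a).eq, ← (ℛ k c).eq]
      simp only [TensorProduct.sum_tmul, TensorProduct.tmul_sum, map_sum, ee_tmul, ww_tmul, straightenAux_tmul, TensorProduct.assoc_symm_tmul, LinearMap.rTensor_tmul, LinearMap.mul'_apply]
      exact Finset.sum_comm
  have h2 : ∀ t, (LinearMap.mul' k (ConvDual k H)).rTensor H
      ((TensorProduct.assoc k _ _ H).symm (((straighten k H).flip q).lTensor _ (straightenAux k H t p)))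
       = ww p q (TensorProduct.map LinearMap.id (TensorProduct.map comul₃ LinearMap.id) t) := by
    intro t
    induction t with
    | zero => simp
    | add s s' hs hs' => simp only [map_add, LinearMap.add_apply, hs, hs']
    | tmul a s =>
    induction s with
    | zero => simp
    | add s s' hs hs' => simp only [TensorProduct.tmul_add, map_add, LinearMap.add_apply, hs, hs']
    | tmul b c =>
      simp only [TensorProduct.map_tmul, LinearMap.id_apply, ww_tmul, straightenAux_tmul, LinearMap.lTensor_tmul]
      rfl
  have h3 := congr($(nest (k := k) (H := H)) h)
  simp only [LinearMap.comp_apply, LinearEquiv.coe_coe] at h3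
  rw [straighten, LinearMap.comp_apply, h1, h3, ← h2]
  rfl

namespace DrinfeldDouble
variable (k H) in
/-- The multiplication of `D(H)` on `H^* ⊗ H`:
`(p ⊗ h) * (q ⊗ g) = ∑ p q(S⁻¹(h₃) ? h₁) ⊗ h₂ g`. -/
noncomputable def mulMap : (ConvDual k H ⊗[k] H) ⊗[k] (ConvDual k H ⊗[k] H) →ₗ[k] ConvDual k H ⊗[k] H :=
  TensorProduct.map (LinearMap.mul' k (ConvDual k H)) (LinearMap.mul' k H) ∘ₗ
  (TensorProduct.assoc k (ConvDual k H) (ConvDual k H) (H ⊗[k] H)).symm.toLinearMap ∘ₗ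
  LinearMap.lTensor (ConvDual k H)
    ((TensorProduct.assoc k (ConvDual k H) H H).toLinearMap ∘ₗ
     LinearMap.rTensor H (TensorProduct.lift (straighten k H)) ∘ₗ
     (TensorProduct.assoc k H (ConvDual k H) H).symm.toLinearMap) ∘ₗ
  (TensorProduct.assoc k (ConvDual k H) H (ConvDual k H ⊗[k] H)).toLinearMap

theorem mulMap_tmul (p q : ConvDual k H) (h g : H) :
    mulMap k H ((p ⊗ₜ h) ⊗ₜ (q ⊗ₜ g)) =
      TensorProduct.map (LinearMap.mulLeft k p) (LinearMap.mulRight k g) (straighten k H h q) := by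
  simp only [mulMap, LinearMap.comp_apply, LinearEquiv.coe_coe, TensorProduct.assoc_tmul, LinearMap.lTensor_tmul,
    TensorProduct.assoc_symm_tmul, LinearMap.rTensor_tmul, TensorProduct.lift.tmul]
  generalize straighten k H h q = t
  induction t with
  | zero => simp
  | tmul a b => simp
  | add a b ha hb => simp only [TensorProduct.add_tmul, TensorProduct.tmul_add, map_add, ha, hb]

theorem mulMap_assoc (x y z : ConvDual k H ⊗[k] H) :
    mulMap k H (mulMap k H (x ⊗ₜ y) ⊗ₜ z) = mulMap k H (x ⊗ₜ mulMap k H (y ⊗ₜ z)) := by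
  induction x with
  | zero => simp
  | add a b ha hb => simp only [TensorProduct.add_tmul, map_add, ha, hb]
  | tmul p h =>
  induction y with
  | zero => simp
  | add a b ha hb => simp only [TensorProduct.add_tmul, TensorProduct.tmul_add, map_add, ha, hb]
  | tmul q g =>
  induction z with
  | zero => simp
  | add a b ha hb => simp only [TensorProduct.tmul_add, map_add, ha, hb]
  | tmul r f =>
  obtain ⟨S, hS⟩ := TensorProduct.exists_finset (straighten k H h q)
  obtain ⟨T, hT⟩ := TensorProduct.exists_finset (straighten k H g r)
  rw [mulMap_tmul, mulMap_tmul, hS, hT]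
  simp only [map_sum, TensorProduct.map_tmul, TensorProduct.sum_tmul, TensorProduct.tmul_sum,
    mulMap_tmul, LinearMap.mulLeft_apply, LinearMap.mulRight_apply, straighten_mul,
    straighten_convMul, hS, hT, LinearMap.rTensor_tmul, LinearMap.lTensor_tmul]
  rw [Finset.sum_comm]
  refine Finset.sum_congr rfl fun j _ => Finset.sum_congr rfl fun i _ => ?_
  rw [LinearMap.flip_apply]
  generalize straighten k H i.2 j.1 = t
  induction t with
  | zero => simp
  | tmul a b => simp [mul_assoc]
  | add a b ha hb => simp only [TensorProduct.add_tmul, TensorProduct.tmul_add, map_add, ha, hb]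

theorem one_mulMap (x : ConvDual k H ⊗[k] H) : mulMap k H ((1 ⊗ₜ 1) ⊗ₜ x) = x := by
  induction x with
  | zero => simp
  | tmul p h => simp [mulMap_tmul, straighten_one]
  | add a b ha hb => simp only [TensorProduct.tmul_add, map_add, ha, hb]

theorem mulMap_one (x : ConvDual k H ⊗[k] H) : mulMap k H (x ⊗ₜ (1 ⊗ₜ 1)) = x := by
  induction x with
  | zero => simp
  | tmul p h => simp [mulMap_tmul, straighten_unit]
  | add a b ha hb => simp only [TensorProduct.add_tmul, map_add, ha, hb]

noncomputable instance : Mul (DrinfeldDouble k H) where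
  mul x y := of k H (mulMap k H ((of k H).symm x ⊗ₜ (of k H).symm y))

noncomputable instance : One (DrinfeldDouble k H) where
  one := of k H (1 ⊗ₜ 1)

theorem mul_def (x y : DrinfeldDouble k H) :
    x * y = of k H (mulMap k H ((of k H).symm x ⊗ₜ (of k H).symm y)) := rfl

/-- The algebra `D(H)`: the product is `mulMap` and the unit is `1 ⊗ 1`, where `1 ∈ H^*` is
the counit of `H`. -/
noncomputable instance : Ring (DrinfeldDouble k H) where
  __ := (inferInstance : AddCommGroup (DrinfeldDouble k H))
  left_distrib x y z := by simp only [mul_def, map_add, TensorProduct.tmul_add]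
  right_distrib x y z := by simp only [mul_def, map_add, TensorProduct.add_tmul]
  zero_mul x := by simp only [mul_def, map_zero, TensorProduct.zero_tmul]
  mul_zero x := by simp only [mul_def, map_zero, TensorProduct.tmul_zero]
  mul_assoc x y z := congrArg (of k H) (mulMap_assoc _ _ _)
  one_mul x := congrArg (of k H) (one_mulMap _)
  mul_one x := congrArg (of k H) (mulMap_one _)

noncomputable instance : Algebra k (DrinfeldDouble k H) :=
  Algebra.ofModule
    (fun r x y => by simp only [mul_def, map_smul, ← TensorProduct.smul_tmul'])
    (fun r x y => by simp only [mul_def, map_smul, TensorProduct.tmul_smul])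

variable (k H) in
/-- The embedding `h ↦ 1 ⊗ h` of `H` in `D(H)`. -/
noncomputable def inclH : H →ₗ[k] DrinfeldDouble k H :=
  (of k H).toLinearMap ∘ₗ TensorProduct.mk k (ConvDual k H) H 1

variable (k H) in
/-- The embedding `p ↦ p ⊗ 1` of `H^{*cop}` in `D(H)`. -/
noncomputable def inclDual : ConvDual k H →ₗ[k] DrinfeldDouble k H :=
  (of k H).toLinearMap ∘ₗ (TensorProduct.mk k (ConvDual k H) H).flip 1

variable (k H) in
/-- The comultiplication of `D(H)`, that of the tensor product coalgebra `H^{*cop} ⊗ H`: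
`p ⊗ h ↦ ∑ (p₂ ⊗ h₁) ⊗ (p₁ ⊗ h₂)`. -/
noncomputable def comulD :
    DrinfeldDouble k H →ₗ[k] DrinfeldDouble k H ⊗[k] DrinfeldDouble k H :=
  TensorProduct.map (of k H).toLinearMap (of k H).toLinearMap ∘ₗ
  (TensorProduct.tensorTensorTensorComm k (ConvDual k H) (ConvDual k H) H H).toLinearMap ∘ₗ
  TensorProduct.map (dualComulCop k H) comul ∘ₗ (of k H).symm.toLinearMap

variable (k H) in
/-- The antipode of `D(H)`: the antihomomorphism equal to `S` on `H` and to the antipode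
`p ↦ p ∘ S⁻¹` of `H^{*cop}` on `H^*`, so that `p ⊗ h ↦ (1 ⊗ S(h)) * ((p ∘ S⁻¹) ⊗ 1)`. -/
noncomputable def antipodeD : DrinfeldDouble k H →ₗ[k] DrinfeldDouble k H :=
  LinearMap.mul' k (DrinfeldDouble k H) ∘ₗ
  TensorProduct.map (inclH k H ∘ₗ antipode k) (inclDual k H ∘ₗ precomp (antipodeInv k H)) ∘ₗ
  (TensorProduct.comm k (ConvDual k H) H).toLinearMap ∘ₗ (of k H).symm.toLinearMap

variable (k H) in
/-- The universal `R`-matrix `∑ hᵢ ⊗ hᵢ^*` of `D(H)`, for a basis `hᵢ` of `H` and its dual basis. -/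
noncomputable def univR : DrinfeldDouble k H ⊗[k] DrinfeldDouble k H :=
  ∑ i, inclH k H (Module.finBasis k H i) ⊗ₜ[k]
    inclDual k H (toConv ((Module.finBasis k H).coord i))

variable (k H) in
/-- The product `R₂₁ R` in the algebra `D(H) ⊗ D(H)`. -/
noncomputable def univR21R : DrinfeldDouble k H ⊗[k] DrinfeldDouble k H :=
  TensorProduct.comm k (DrinfeldDouble k H) (DrinfeldDouble k H) (univR k H) * univR k H

variable (k H) in
/-- The Drinfeld element `u = m (S ⊗ I) τ (R) = ∑ S(hᵢ^*) hᵢ`. -/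
noncomputable def drinfeldElement : DrinfeldDouble k H :=
  LinearMap.mul' k (DrinfeldDouble k H) ((antipodeD k H).rTensor (DrinfeldDouble k H)
    (TensorProduct.comm k (DrinfeldDouble k H) (DrinfeldDouble k H) (univR k H)))

variable (k H) in
/-- The product `R * (I ⊗ S²)(R) * ⋯ * (I ⊗ S²ⁿ⁻²)(R)`, in this order. -/
noncomputable def twistedRProd (n : ℕ) : DrinfeldDouble k H ⊗[k] DrinfeldDouble k H :=
  ((List.range n).map fun i =>
    ((antipodeD k H : Module.End k (DrinfeldDouble k H)) ^ (2 * i)).lTensor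
      (DrinfeldDouble k H) (univR k H)).prod

end DrinfeldDouble

end FiniteDim

/-- The smallest positive integer satisfying `P`, or `∞` if there is none. -/
noncomputable def leastPos (P : ℕ → Prop) : ℕ∞ :=
  ⨅ n ∈ {n : ℕ | 0 < n ∧ P n}, (n : ℕ∞)

/-- The order of an element: the smallest positive `n` with `x ^ n = 1`, or `∞`. -/
noncomputable def order {M : Type*} [Monoid M] (x : M) : ℕ∞ :=
  leastPos fun n => x ^ n = 1

variable (k H) in
/-- The iterated coproduct `Δₙ : H → H^{⊗ n}`, with `Δₙ₊₁ = (Δₙ ⊗ I) ∘ Δ`. The recursion starts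
at `Δ₀ = ε`, so that `Δ₁ = (ε ⊗ I) ∘ Δ` is the identification of `H` with `H^{⊗ 1}`. -/
noncomputable def iterComul : (n : ℕ) → H →ₗ[k] ⨂[k]^n H
  | 0 => (TensorPower.algebraMap₀ (R := k) (M := H)).toLinearMap ∘ₗ counit
  | n + 1 => (TensorPower.mulEquiv (R := k) (M := H)).toLinearMap ∘ₗ
      TensorProduct.map (iterComul n)
        (PiTensorProduct.subsingletonEquiv (R := k) (s := fun _ : Fin 1 => H) 0).symm.toLinearMap ∘ₗ
      comul

variable (k H) in
/-- The iterated product `mₙ : H^{⊗ n} → H`, `x₁ ⊗ ⋯ ⊗ xₙ ↦ x₁ ⋯ xₙ`. -/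
noncomputable def iterMul (n : ℕ) : (⨂[k]^n H) →ₗ[k] H :=
  PiTensorProduct.lift (MultilinearMap.mkPiAlgebraFin k n H)

variable (k H) in
/-- `mₙ ∘ (I ⊗ S⁻² ⊗ ⋯ ⊗ S⁻²ⁿ⁺²) ∘ Δₙ`. -/
noncomputable def twistedPower [FiniteDimensional k H] (n : ℕ) : H →ₗ[k] H :=
  iterMul k H n ∘ₗ
  PiTensorProduct.map (fun i : Fin n => (antipodeInv k H : Module.End k H) ^ (2 * (i : ℕ))) ∘ₗ
  iterComul k H n

variable (k H) in
/-- The exponent of `H`: the smallest positive `n` with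
`mₙ ∘ (I ⊗ S⁻² ⊗ ⋯ ⊗ S⁻²ⁿ⁺²) ∘ Δₙ = ε · 1`, or `∞`. -/
noncomputable def exponent [FiniteDimensional k H] : ℕ∞ :=
  leastPos fun n => twistedPower k H n = Algebra.linearMap k H ∘ₗ counit

end FinHopf

set_option linter.unusedSectionVars false

namespace FinHopf

open Coalgebra WithConv HopfAlgebra

variable {k H : Type*} [Field k] [Ring H] [HopfAlgebra k H] [FiniteDimensional k H]

/-! Write `P n` for `twistedPower k H n`, `R` for `univR`, `Q` for `univR21R` and `u` for the
Drinfeld element. Everything is compared with the condition that `P n` is the convolution unit.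

Since `H` is finite-dimensional, `A ⊗ H^*` is the space of linear maps `H → A`, through `f ↦ ∑ f(hᵢ)
⊗ hᵢ^*`, and the product of tensors becomes convolution (`canonMap_mul`). The antipode of the double
acts on `H^*` by `p ↦ p ∘ S⁻¹`, so `(I ⊗ S²ⁱ)(R)` corresponds to `S⁻²ⁱ`, and the product in item 1
corresponds to `P n` (`twistedRProd_eq`). The correspondence is injective, which gives item 1.

For item 2, `u = ∑ hᵢ^* S⁻¹(hᵢ)` and `u q = (q ∘ S⁻²) u` for `q ∈ H^*`
(`drinfeldElement_mul_algDual`). Moving all dual vectors in `uⁿ` to the left gives `uⁿ = ∑ hᵢ^* P n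
(S⁻¹ hᵢ)` (`drinfeldElement_pow`). Applying the evaluations `p ⊗ h ↦ p(a) h` shows that `uⁿ = 1`
exactly when `P n` is trivial.

For item 3, `Δ(u) Q = u ⊗ u` and `Q` commutes with the image of `Δ`, so `Δ(uⁿ) Qⁿ = uⁿ ⊗ uⁿ`. If `uⁿ
= 1` then `Qⁿ = 1`. If `Qⁿ = 1` then `uⁿ` satisfies `Δ(x) = x ⊗ x`, so it is determined by its value
at `1 ∈ H` and by the counits of its values; these are the ones of `1`.

For item 4, the same identity for `v` shows that `vⁿ = 1` implies `Qⁿ = 1`. Conversely, if `Qⁿ = 1`,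
then `uⁿ = 1` and `g = u⁻¹ v` is group-like, hence a product of a character of `H` and a group-like
element of `H` (`exists_of_groupLike`). Such a `g` commutes with `u`, and `gⁿ = 1` because `P n`
restricts to the `n`-th power on group-likes and on characters. So `vⁿ = uⁿ gⁿ = 1`.

The structural input is that `Δ` is an algebra map on the double and that `R` intertwines it with
its opposite. Both come from a universal property: algebra maps on `H` and `H^*` glue to the double
once they satisfy `Δᵒᵖ(h) R = R Δ(h)`. -/

/-! ### Linear maps on `H` as elements of `A ⊗ H^*` -/

variable (k H) in
/-- The vectors of the dual basis of `Module.finBasis k H`, in the convolution algebra. -/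
noncomputable def dualVec (i : Fin (Module.finrank k H)) : ConvDual k H :=
  toConv ((Module.finBasis k H).coord i)

theorem dualVec_apply (i) (x : H) : (dualVec k H i).ofConv x = (Module.finBasis k H).repr x i := rfl

theorem sum_smul_dualVec (p : ConvDual k H) : ∑ i, p.ofConv (Module.finBasis k H i) • dualVec k H i = p := by
  apply WithConv.ofConv_injective
  refine (Module.finBasis k H).ext fun j => ?_
  simp [WithConv.ofConv_sum, LinearMap.sum_apply, dualVec_apply, Finsupp.single_apply]

/-- Evaluation of the second leg of an element of `A ⊗ H^*`. -/
noncomputable def evalSnd (A : Type*) [AddCommGroup A] [Module k A] (x : H) :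
    A ⊗[k] ConvDual k H →ₗ[k] A :=
  (TensorProduct.rid k A).toLinearMap ∘ₗ
    LinearMap.lTensor A (LinearMap.applyₗ x ∘ₗ (WithConv.linearEquiv k (H →ₗ[k] k)).toLinearMap)

section
variable {A : Type*} [AddCommGroup A] [Module k A]

@[simp] theorem evalSnd_tmul (x : H) (a : A) (p : ConvDual k H) :
    evalSnd A x (a ⊗ₜ p) = p.ofConv x • a := by
  simp [evalSnd]

theorem sum_evalSnd (t : A ⊗[k] ConvDual k H) : ∑ i, evalSnd A (Module.finBasis k H i) t ⊗ₜ dualVec k H i = t := by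
  induction t with
  | zero => simp
  | tmul a p =>
    simp only [evalSnd_tmul, TensorProduct.smul_tmul, ← TensorProduct.tmul_sum, sum_smul_dualVec]
  | add s t hs ht => simp only [map_add, TensorProduct.add_tmul, Finset.sum_add_distrib, hs, ht]

theorem ext_evalSnd {s t : A ⊗[k] ConvDual k H} (h : ∀ x, evalSnd A x s = evalSnd A x t) :
    s = t := by
  rw [← sum_evalSnd s, ← sum_evalSnd t]
  simp only [h]

/-- The element `∑ f(hᵢ) ⊗ hᵢ^*` of `A ⊗ H^*` attached to `f : H → A`. -/
noncomputable def canon (f : H →ₗ[k] A) : A ⊗[k] ConvDual k H := ∑ i, f (Module.finBasis k H i) ⊗ₜ dualVec k H i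

@[simp] theorem evalSnd_canon (x : H) (f : H →ₗ[k] A) : evalSnd A x (canon f) = f x := by
  simp only [canon, map_sum, evalSnd_tmul, ← map_smul, dualVec_apply]
  rw [← map_sum, (Module.finBasis k H).sum_repr]

theorem canon_injective : Function.Injective (canon : (H →ₗ[k] A) → A ⊗[k] ConvDual k H) := by
  intro f g h
  ext x
  rw [← evalSnd_canon x f, h, evalSnd_canon]

/-- The transpose rule: an endomorphism acting on the dual leg can be moved to the `H` leg. -/
theorem canon_comp (f : H →ₗ[k] A) (g : H →ₗ[k] H) :
    LinearMap.lTensor A (precomp g) (canon f) = canon (f ∘ₗ g) := by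
  refine ext_evalSnd fun x => ?_
  rw [evalSnd_canon, LinearMap.comp_apply, ← evalSnd_canon (g x) f]
  simp only [canon, map_sum, LinearMap.lTensor_tmul, evalSnd_tmul]
  rfl

end

/-! ### Contractions, and convolution as multiplication of tensors -/

section
variable {B : Type*} [Ring B] [Algebra k B]

/-- The element `∑ hᵢ^* f(hᵢ)` of `B`, where `H^*` acts through `β`. -/
noncomputable def contr (β : ConvDual k H →ₐ[k] B) (f : H →ₗ[k] B) : B := ∑ i, β (dualVec k H i) * f (Module.finBasis k H i)

theorem dualVec_mul_dualVec (i j) :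
    dualVec k H i * dualVec k H j = ∑ l, (dualVec k H i * dualVec k H j).ofConv (Module.finBasis k H l) • dualVec k H l := (sum_smul_dualVec _).symm

/-- The coefficients `(hᵢ^* hⱼ^*)(x)` are the coordinates of `Δ(x)` in the basis `hᵢ ⊗ hⱼ`. This
duality between convolution and comultiplication underlies `contr_contr` and `canonMap_mul`. -/
theorem sum_dualVec_mul_smul {M : Type*} [AddCommGroup M] [Module k M] (F : H →ₗ[k] H →ₗ[k] M)
    (x : H) : ∑ i, ∑ j, (dualVec k H i * dualVec k H j).ofConv x • F (Module.finBasis k H i) (Module.finBasis k H j) = TensorProduct.lift F (comul x) := by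
  have key : ∀ t : H ⊗[k] H, ∑ i, ∑ j,
      LinearMap.mul' k k (TensorProduct.map ((Module.finBasis k H).coord i) ((Module.finBasis k H).coord j) t) • F (Module.finBasis k H i) (Module.finBasis k H j) =
      TensorProduct.lift F t := by
    intro t
    induction t with
    | zero => simp
    | tmul x y =>
      conv_rhs => rw [TensorProduct.lift.tmul, ← (Module.finBasis k H).sum_repr x, ← (Module.finBasis k H).sum_repr y]
      simp only [map_sum, map_smul, LinearMap.sum_apply, LinearMap.smul_apply, smul_smul, Finset.smul_sum,
        TensorProduct.map_tmul, LinearMap.mul'_apply, Module.Basis.coord_apply]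
      rw [Finset.sum_comm]
      simp only [mul_comm]
    | add s t hs ht => simp only [map_add, add_smul, Finset.sum_add_distrib, hs, ht]
  exact key _

/-- Two adjacent dual vectors merge into one, at the price of splitting the argument by `Δ`. -/
theorem contr_contr (β : ConvDual k H →ₐ[k] B) (F : H →ₗ[k] H →ₗ[k] B) :
    ∑ i, β (dualVec k H i) * contr β (F (Module.finBasis k H i)) = contr β (TensorProduct.lift F ∘ₗ comul) := by
  simp only [contr, Finset.mul_sum, ← mul_assoc, ← map_mul, LinearMap.comp_apply,
    ← sum_dualVec_mul_smul]
  conv_lhs => enter [2, i, 2, j]; rw [dualVec_mul_dualVec]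
  simp only [map_sum, map_smul, Finset.sum_mul, smul_mul_assoc, mul_smul_comm]
  conv_lhs => enter [2, i]; rw [Finset.sum_comm]
  rw [Finset.sum_comm]

/-- The element `∑ f(hᵢ) ⊗ hᵢ^*` of `A ⊗ B` attached to `f : H → A`. -/
noncomputable def canonMap {A : Type*} [Ring A] [Algebra k A] (β : ConvDual k H →ₐ[k] B)
    (f : H →ₗ[k] A) : A ⊗[k] B :=
  ∑ i, f (Module.finBasis k H i) ⊗ₜ β (dualVec k H i)

theorem sum_tmul_mul {A : Type*} [AddCommGroup A] [Module k A] (β : ConvDual k H →ₐ[k] B)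
    (F : H →ₗ[k] H →ₗ[k] A) :
    ∑ i, ∑ j, F (Module.finBasis k H i) (Module.finBasis k H j) ⊗ₜ[k] (β (dualVec k H i) * β (dualVec k H j)) =
      ∑ l, TensorProduct.lift F (comul (Module.finBasis k H l)) ⊗ₜ[k] β (dualVec k H l) := by
  simp only [← map_mul, ← sum_dualVec_mul_smul, TensorProduct.sum_tmul]
  conv_lhs => enter [2, i, 2, j]; rw [dualVec_mul_dualVec]
  simp only [map_sum, map_smul, TensorProduct.tmul_sum, ← TensorProduct.smul_tmul]
  conv_lhs => enter [2, i]; rw [Finset.sum_comm]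
  rw [Finset.sum_comm]

section
variable {A : Type*} [Ring A] [Algebra k A]

theorem canonMap_mul (β : ConvDual k H →ₐ[k] B) (f g : WithConv (H →ₗ[k] A)) :
    canonMap β f.ofConv * canonMap β g.ofConv = canonMap β (f * g).ofConv := by
  have h := sum_tmul_mul β ((LinearMap.mul k A).compl₁₂ f.ofConv g.ofConv)
  simp only [canonMap, Finset.sum_mul_sum, Algebra.TensorProduct.tmul_mul_tmul]
  refine h.trans (Finset.sum_congr rfl fun l _ => ?_)
  congr 1
  rw [LinearMap.convMul_apply]
  generalize comul (R := k) (Module.finBasis k H l) = t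
  induction t with
  | zero => simp
  | tmul a b => simp
  | add a b ha hb => simp only [map_add, ha, hb]

theorem canonMap_one (β : ConvDual k H →ₐ[k] B) :
    canonMap β (1 : WithConv (H →ₗ[k] A)).ofConv = 1 := by
  have h := sum_smul_dualVec (1 : ConvDual k H)
  simp only [canonMap, LinearMap.convOne_apply, Algebra.algebraMap_eq_smul_one,
    TensorProduct.smul_tmul, ← TensorProduct.tmul_sum] at h ⊢
  rw [Algebra.TensorProduct.one_def, ← map_one β]
  conv_rhs => rw [← h]
  simp

theorem lTensor_canon (β : ConvDual k H →ₐ[k] B) (f : H →ₗ[k] A) :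
    LinearMap.lTensor A β.toLinearMap (canon f) = canonMap β f := by
  simp [canon, canonMap]
end

theorem contr_comp (β : ConvDual k H →ₐ[k] B) (f : H →ₗ[k] B) (g : H →ₗ[k] H) :
    contr β (f ∘ₗ g) = ∑ i, β (precomp g (dualVec k H i)) * f (Module.finBasis k H i) := by
  have := congr(LinearMap.mul' k B (TensorProduct.comm k B B
    (LinearMap.lTensor B β.toLinearMap $(canon_comp f g))))
  simp only [canon, map_sum, LinearMap.lTensor_tmul, TensorProduct.comm_tmul,
    LinearMap.mul'_apply] at this
  exact this.symm

theorem map_contr {B' : Type*} [Ring B'] [Algebra k B'] (φ : B →ₐ[k] B')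
    (β : ConvDual k H →ₐ[k] B) (f : H →ₗ[k] B) :
    φ (contr β f) = contr (φ.comp β) (φ.toLinearMap ∘ₗ f) := by
  simp [contr]

/-! ### Identities for `S⁻¹` and the universal element of `H ⊗ B` -/

variable (k H) in
theorem mul_antipodeInv_comm_comul (x : H) :
    LinearMap.mul' k H (LinearMap.lTensor H (antipodeInv k H) (TensorProduct.comm k H H (comul x)))
      = algebraMap k H (counit x) := by
  have h := congr(antipodeInv k H $(mul_antipode_lTensor_comul_apply (R := k) x))
  rw [Algebra.algebraMap_eq_smul_one, map_smul, antipodeInv_one, ← Algebra.algebraMap_eq_smul_one] at h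
  rw [← h]
  generalize comul (R := k) x = t
  induction t with
  | zero => simp
  | tmul a b => simp [antipodeInv_mul, antipodeInv_antipode]
  | add a b ha hb => simp only [map_add, ha, hb]

theorem mul_rTensor_antipodeInv_comm_comul (x : H) :
    LinearMap.mul' k H (LinearMap.rTensor H (antipodeInv k H) (TensorProduct.comm k H H (comul x)))
      = algebraMap k H (counit x) := by
  have h := congr(antipodeInv k H $(mul_antipode_rTensor_comul_apply (R := k) x))
  rw [Algebra.algebraMap_eq_smul_one, map_smul, antipodeInv_one, ← Algebra.algebraMap_eq_smul_one] at h
  rw [← h]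
  generalize comul (R := k) x = t
  induction t with
  | zero => simp
  | tmul a b => simp [antipodeInv_mul, antipodeInv_antipode]
  | add a b ha hb => simp only [map_add, ha, hb]

/-- The universal element `∑ hᵢ ⊗ hᵢ^*` in `H ⊗ B`. -/
noncomputable def univ (β : ConvDual k H →ₐ[k] B) : H ⊗[k] B := ∑ i, Module.finBasis k H i ⊗ₜ β (dualVec k H i)

theorem map_univ {B' : Type*} [Ring B'] [Algebra k B'] (φ : B →ₐ[k] B')
    (β : ConvDual k H →ₐ[k] B) :
    Algebra.TensorProduct.map (AlgHom.id k H) φ (univ β) = univ (φ.comp β) := by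
  simp [univ]

/-- `h ↦ h₁ ⊗ h₂` in `H ⊗ B`. -/
noncomputable def legComul (α : H →ₐ[k] B) : H →ₐ[k] H ⊗[k] B :=
  (Algebra.TensorProduct.map (AlgHom.id k H) α).comp (Bialgebra.comulAlgHom k H)

/-- `h ↦ h₂ ⊗ h₁` in `H ⊗ B`. -/
noncomputable def legComulOp (α : H →ₐ[k] B) : H →ₐ[k] H ⊗[k] B :=
  (Algebra.TensorProduct.map (AlgHom.id k H) α).comp
    ((Algebra.TensorProduct.comm k H H).toAlgHom.comp (Bialgebra.comulAlgHom k H))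

theorem legComul_apply (α : H →ₐ[k] B) (h : H) :
    legComul α h = LinearMap.lTensor H α.toLinearMap (comul h) := rfl

theorem legComulOp_apply (α : H →ₐ[k] B) (h : H) :
    legComulOp α h = LinearMap.lTensor H α.toLinearMap (TensorProduct.comm k H H (comul h)) := rfl

/-- `∑ (1 ⊗ hᵢ^*) (∑ hⱼ ⊗ hⱼ^*) Δ(S⁻¹(hᵢ)) = 1 ⊗ ∑ hᵢ^* S⁻¹(hᵢ)`. -/
theorem contr_univ_mul_legComul (α : H →ₐ[k] B) (β : ConvDual k H →ₐ[k] B) :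
    ∑ i, (1 ⊗ₜ β (dualVec k H i)) * (univ β * legComul α (antipodeInv k H (Module.finBasis k H i))) =
      1 ⊗ₜ[k] contr β (α.toLinearMap ∘ₗ antipodeInv k H) := by
  -- With `F x y = (y ⊗ 1) Δ(S⁻¹ x)`, merging the two sums evaluates `F` on `Δ(h)`. This is `h₃
  -- S⁻¹(h₂) ⊗ S⁻¹(h₁)`, whose first leg collapses.
  let F : H →ₗ[k] H →ₗ[k] H ⊗[k] B :=
    (LinearMap.mul k (H ⊗[k] B)).flip.compl₁₂ ((legComul α).toLinearMap ∘ₗ antipodeInv k H)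
      (Algebra.TensorProduct.includeLeft (R := k) (S := k) (A := H) (B := B)).toLinearMap
  let β' : ConvDual k H →ₐ[k] H ⊗[k] B := Algebra.TensorProduct.includeRight.comp β
  have h1 := contr_contr β' F
  let G : H ⊗[k] (H ⊗[k] H) →ₗ[k] H ⊗[k] B :=
    TensorProduct.map (LinearMap.mul' k H ∘ₗ LinearMap.lTensor H (antipodeInv k H) ∘ₗ
      (TensorProduct.comm k H H).toLinearMap) (α.toLinearMap ∘ₗ antipodeInv k H) ∘ₗ
      (TensorProduct.comm k H (H ⊗[k] H)).toLinearMap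
  have h2 : ∀ t : H ⊗[k] H, TensorProduct.lift F t =
      G (TensorProduct.assoc k H H H (comul.rTensor H t)) := by
    intro t
    induction t with
    | zero => simp
    | tmul x y =>
      simp only [F, TensorProduct.lift.tmul, LinearMap.compl₁₂_apply, LinearMap.flip_apply,
        LinearMap.comp_apply, AlgHom.toLinearMap_apply, legComul_apply, comul_antipodeInv,
        LinearMap.rTensor_tmul]
      generalize comul (R := k) x = s
      induction s with
      | zero => simp
      | tmul a b => simp [G]
      | add a b ha hb => simp only [map_add, ha, hb, TensorProduct.add_tmul]
    | add a b ha hb => simp only [map_add, ha, hb]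
  have h3 : ∀ t : H ⊗[k] H, G (comul.lTensor H t) =
      1 ⊗ₜ α (antipodeInv k H (TensorProduct.rid k H (counit.lTensor H t))) := by
    intro t
    induction t with
    | zero => simp
    | tmul x y =>
      simp only [G, LinearMap.lTensor_tmul, LinearMap.comp_apply, LinearEquiv.coe_coe,
        TensorProduct.comm_tmul, TensorProduct.map_tmul, mul_antipodeInv_comm_comul,
        TensorProduct.rid_tmul, map_smul, Algebra.algebraMap_eq_smul_one, TensorProduct.smul_tmul,
        AlgHom.toLinearMap_apply]
    | add a b ha hb => simp only [map_add, ha, hb, TensorProduct.tmul_add]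
  have h4 : TensorProduct.lift F ∘ₗ comul =
      (Algebra.TensorProduct.includeRight (R := k) (A := H) (B := B)).toLinearMap ∘ₗ
        (α.toLinearMap ∘ₗ antipodeInv k H) := by
    ext x
    rw [LinearMap.comp_apply, h2, Coalgebra.coassoc_apply, h3, Coalgebra.lTensor_counit_comul]
    simp
  rw [h4] at h1
  have h5 := map_contr (Algebra.TensorProduct.includeRight (R := k) (A := H) (B := B)) β
    (α.toLinearMap ∘ₗ antipodeInv k H)
  rw [← h5] at h1
  refine Eq.trans ?_ h1
  refine Finset.sum_congr rfl fun i _ => ?_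
  simp [contr, univ, Finset.sum_mul, Finset.mul_sum, β', F, ← mul_assoc]
end

/-- With `ext_dualVec`, this turns one identity involving the universal element into an identity
valid for every `q ∈ H^*`. -/
theorem eq_of_sum_basis_tmul_eq {M : Type*} [AddCommGroup M] [Module k M]
    {f g : Fin (Module.finrank k H) → M}
    (h : ∑ i, Module.finBasis k H i ⊗ₜ[k] f i = ∑ i, Module.finBasis k H i ⊗ₜ[k] g i) (i) : f i = g i := by
  have := congr(TensorProduct.lid k M (LinearMap.rTensor M ((Module.finBasis k H).coord i) $h))
  simpa [Finsupp.single_apply] using this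

theorem ext_dualVec {M : Type*} [AddCommGroup M] [Module k M] {f g : ConvDual k H →ₗ[k] M}
    (h : ∀ i, f (dualVec k H i) = g (dualVec k H i)) : f = g := by
  ext p
  rw [← sum_smul_dualVec p]
  simp only [map_sum, map_smul, h]

theorem sum_tmul_precomp {M : Type*} [AddCommGroup M] [Module k M] (f : H →ₗ[k] M) (g : H →ₗ[k] H) :
    ∑ i, f (Module.finBasis k H i) ⊗ₜ[k] precomp g (dualVec k H i) = ∑ i, f (g (Module.finBasis k H i)) ⊗ₜ[k] dualVec k H i := by
  have h := canon_comp f g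
  simpa only [canon, map_sum, LinearMap.lTensor_tmul, LinearMap.comp_apply] using h

theorem comul₃_assoc_comul (h : H) :
    LinearMap.lTensor H (TensorProduct.assoc k H H H).toLinearMap
      (TensorProduct.assoc k H (H ⊗[k] H) H (LinearMap.rTensor H comul₃ (comul h))) =
    LinearMap.lTensor H (LinearMap.lTensor H comul) (comul₃ (k := k) h) := by
  have : LinearMap.lTensor H (TensorProduct.assoc k H H H).toLinearMap ∘ₗ
      (TensorProduct.assoc k H (H ⊗[k] H) H).toLinearMap ∘ₗ LinearMap.rTensor H comul₃ ∘ₗ comul =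
      LinearMap.lTensor H (LinearMap.lTensor H comul) ∘ₗ (comul₃ (k := k)) := by
    simp only [comul₃]
    simp only [coassoc_simps]
  exact congr($this h)

theorem lTensor_lTensor_counit_comul₃ (h : H) :
    LinearMap.lTensor H (LinearMap.lTensor H counit) (comul₃ (k := k) h) =
      LinearMap.lTensor H ((TensorProduct.mk k H k).flip 1) (comul h) := by
  simp only [comul₃, LinearMap.comp_apply]
  rw [← LinearMap.comp_apply (LinearMap.lTensor H _), ← LinearMap.lTensor_comp,
    Coalgebra.lTensor_counit_comp_comul]

/-! ### The exchange relation and the universal property of the double -/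

section Exchange
variable {B : Type*} [Ring B] [Algebra k B]

/-- The exchange relation `Δᵒᵖ(h) R = R Δ(h)` between algebra maps on `H` and `H^*`. -/
def Exchange (α : H →ₐ[k] B) (β : ConvDual k H →ₐ[k] B) : Prop :=
  ∀ h, legComulOp α h * univ β = univ β * legComul α h

/-- Transposing the translations in `straighten` turns the left side into `(S⁻¹(h₃) ⊗ 1) R (h₁ ⊗
h₂)`, that is `(S⁻¹(h₂) ⊗ 1) R Δ(h₁)`. The exchange relation makes this `(S⁻¹(h₃) h₂ ⊗ h₁) R = (1 ⊗
h) R`. -/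
theorem exchange_iff_sum (α : H →ₐ[k] B) (β : ConvDual k H →ₐ[k] B) (hαβ : Exchange α β) (h : H) :
    ∑ i, Module.finBasis k H i ⊗ₜ[k] (LinearMap.mul' k B (TensorProduct.map β.toLinearMap α.toLinearMap
      (straighten k H h (dualVec k H i)))) = ∑ i, Module.finBasis k H i ⊗ₜ[k] (α h * β (dualVec k H i)) := by
  -- `G` is `a ⊗ b ⊗ c ↦ (S⁻¹(c) ⊗ 1) R (a ⊗ b)`
  let G : (H ⊗[k] H) ⊗[k] H →ₗ[k] H ⊗[k] B :=
    LinearMap.mul' k (H ⊗[k] B) ∘ₗ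
      TensorProduct.map ((Algebra.TensorProduct.includeLeft (R := k) (S := k) (A := H)
        (B := B)).toLinearMap ∘ₗ antipodeInv k H)
        (LinearMap.mulLeft k (univ β) ∘ₗ LinearMap.lTensor H α.toLinearMap) ∘ₗ
      (TensorProduct.comm k (H ⊗[k] H) H).toLinearMap
  have h1 : ∀ t : H ⊗[k] (H ⊗[k] H), ∑ i, Module.finBasis k H i ⊗ₜ[k] (LinearMap.mul' k B
      (TensorProduct.map β.toLinearMap α.toLinearMap (straightenAux k H t (dualVec k H i)))) =
      G ((TensorProduct.assoc k H H H).symm t) := by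
    intro t
    induction t with
    | zero => simp
    | add s t hs ht =>
      simp only [map_add, LinearMap.add_apply, TensorProduct.tmul_add, Finset.sum_add_distrib, hs, ht]
    | tmul a t =>
    induction t with
    | zero => simp
    | add s t hs ht =>
      simp only [map_add, LinearMap.add_apply, TensorProduct.tmul_add, Finset.sum_add_distrib, hs, ht]
    | tmul b c =>
      have h0 := congr(LinearMap.lTensor H (LinearMap.mulRight k (α b) ∘ₗ β.toLinearMap)
        $(sum_tmul_precomp (LinearMap.id : H →ₗ[k] H)
        (LinearMap.mulRight k a ∘ₗ LinearMap.mulLeft k (antipodeInv k H c))))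
      simp only [map_sum, LinearMap.lTensor_tmul] at h0
      refine h0.trans ?_
      simp [G, univ, Finset.sum_mul, Finset.mul_sum, mul_assoc]
  have h2 : straighten k H h = straightenAux k H (comul.lTensor H (comul h)) := rfl
  rw [h2, h1, Coalgebra.coassoc_symm_apply]
  have h3 : ∀ t : H ⊗[k] H, G (LinearMap.rTensor H comul t) =
      LinearMap.mul' k (H ⊗[k] B) (TensorProduct.map ((Algebra.TensorProduct.includeLeft (R := k)
        (S := k) (A := H) (B := B)).toLinearMap ∘ₗ antipodeInv k H) (legComulOp α).toLinearMap
        (TensorProduct.comm k H H t)) * univ β := by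
    intro t
    induction t with
    | zero => simp
    | add s t hs ht => simp only [map_add, hs, ht, add_mul]
    | tmul a c =>
      simp only [G, LinearMap.rTensor_tmul, LinearMap.comp_apply, LinearEquiv.coe_coe,
        TensorProduct.comm_tmul, TensorProduct.map_tmul, LinearMap.mul'_apply,
        LinearMap.mulLeft_apply, AlgHom.toLinearMap_apply, mul_assoc]
      rw [hαβ a, legComul_apply]
  rw [h3]
  let G' : H ⊗[k] (H ⊗[k] H) →ₗ[k] H ⊗[k] B :=
    TensorProduct.map (LinearMap.mul' k H ∘ₗ LinearMap.rTensor H (antipodeInv k H) ∘ₗ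
      (TensorProduct.comm k H H).toLinearMap) α.toLinearMap ∘ₗ
      (TensorProduct.comm k H (H ⊗[k] H)).toLinearMap
  have h4 : ∀ t : H ⊗[k] H, LinearMap.mul' k (H ⊗[k] B) (TensorProduct.map
      ((Algebra.TensorProduct.includeLeft (R := k) (S := k) (A := H) (B := B)).toLinearMap ∘ₗ
        antipodeInv k H) (legComulOp α).toLinearMap (TensorProduct.comm k H H t)) =
      G' (TensorProduct.assoc k H H H (LinearMap.rTensor H comul t)) := by
    intro t
    induction t with
    | zero => simp
    | add s t hs ht => simp only [map_add, hs, ht]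
    | tmul a c =>
      simp only [TensorProduct.comm_tmul, TensorProduct.map_tmul, LinearMap.mul'_apply,
        AlgHom.toLinearMap_apply, legComulOp_apply, LinearMap.rTensor_tmul]
      generalize comul (R := k) a = s
      induction s with
      | zero => simp
      | add s t hs ht => simp only [map_add, hs, ht, mul_add, TensorProduct.add_tmul]
      | tmul x y => simp [G']
  have h5 : ∀ t : H ⊗[k] H, G' (LinearMap.lTensor H comul t) =
      1 ⊗ₜ α (TensorProduct.rid k H (counit.lTensor H t)) := by
    intro t
    induction t with
    | zero => simp
    | add s t hs ht => simp only [map_add, hs, ht, TensorProduct.tmul_add]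
    | tmul a c =>
      simp only [G', LinearMap.lTensor_tmul, LinearMap.comp_apply, LinearEquiv.coe_coe,
        TensorProduct.comm_tmul, TensorProduct.map_tmul, mul_rTensor_antipodeInv_comm_comul,
        TensorProduct.rid_tmul, map_smul, Algebra.algebraMap_eq_smul_one, TensorProduct.smul_tmul,
        AlgHom.toLinearMap_apply]
  rw [h4, Coalgebra.coassoc_apply, h5, Coalgebra.lTensor_counit_comul]
  simp [univ, Finset.mul_sum]

end Exchange

namespace DrinfeldDouble

theorem of_mulMap (x y : ConvDual k H ⊗[k] H) :
    of k H x * of k H y = of k H (mulMap k H (x ⊗ₜ y)) := rfl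

theorem inclH_apply (h : H) : inclH k H h = of k H (1 ⊗ₜ h) := rfl

theorem inclDual_apply (p : ConvDual k H) : inclDual k H p = of k H (p ⊗ₜ 1) := rfl

variable (k H) in
/-- The embedding of `H` in `D(H)` as an algebra map. -/
noncomputable def algH : H →ₐ[k] DrinfeldDouble k H :=
  AlgHom.ofLinearMap (inclH k H) rfl fun x y => by
    simp [inclH_apply, of_mulMap, mulMap_tmul, straighten_unit]

variable (k H) in
/-- The embedding of `H^*` in `D(H)` as an algebra map. -/
noncomputable def algDual : ConvDual k H →ₐ[k] DrinfeldDouble k H :=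
  AlgHom.ofLinearMap (inclDual k H) rfl fun x y => by
    simp [inclDual_apply, of_mulMap, mulMap_tmul, straighten_one]

theorem algH_apply (h : H) : algH k H h = of k H (1 ⊗ₜ h) := rfl

theorem algDual_apply (p : ConvDual k H) : algDual k H p = of k H (p ⊗ₜ 1) := rfl

theorem of_tmul (p : ConvDual k H) (h : H) : of k H (p ⊗ₜ h) = algDual k H p * algH k H h := by
  simp [algH_apply, algDual_apply, of_mulMap, mulMap_tmul, straighten_one]

theorem algH_mul_algDual (h : H) (p : ConvDual k H) :
    algH k H h * algDual k H p = of k H (straighten k H h p) := by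
  have : ∀ t : ConvDual k H ⊗[k] H,
      TensorProduct.map (LinearMap.mulLeft k 1) (LinearMap.mulRight k 1) t = t := by
    intro t
    simp
  simp only [algH_apply, algDual_apply, of_mulMap, mulMap_tmul, this]

@[elab_as_elim]
theorem induction_on' {P : DrinfeldDouble k H → Prop} (x : DrinfeldDouble k H)
    (tmul : ∀ p h, P (algDual k H p * algH k H h)) (zero : P 0)
    (add : ∀ x y, P x → P y → P (x + y)) : P x := by
  obtain ⟨t, rfl⟩ := (of k H).surjective x
  induction t with
  | zero => simpa using zero
  | tmul p h => rw [of_tmul]; exact tmul p h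
  | add s t hs ht => rw [map_add]; exact add _ _ hs ht

/-- Straightening `h₁ hᵢ^*` in `Δᵒᵖ(h) R` and transposing the translations gives `∑ h₄ S⁻¹(h₃) hᵢ h₁
⊗ hᵢ^* h₂`. The factor `h₄ S⁻¹(h₃)` collapses and leaves `R Δ(h)`. -/
theorem exchange_algH_algDual : Exchange (algH k H) (algDual k H) := by
  intro h
  -- `V` is the linear form of `R Δ(h)` with room for an extra left factor `c` on the first leg,
  -- which will be `h₄ S⁻¹(h₃)`.
  let V : H ⊗[k] (H ⊗[k] H) →ₗ[k] H ⊗[k] DrinfeldDouble k H :=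
    ∑ i, TensorProduct.map (LinearMap.mul' k H ∘ₗ LinearMap.rTensor H (LinearMap.mulRight k (Module.finBasis k H i)) ∘ₗ
        (TensorProduct.comm k H H).toLinearMap)
        (LinearMap.mulLeft k (algDual k H (dualVec k H i)) ∘ₗ (algH k H).toLinearMap) ∘ₗ
      (TensorProduct.assoc k H H H).symm.toLinearMap ∘ₗ
      LinearMap.lTensor H (TensorProduct.comm k H H).toLinearMap
  have hV : ∀ a b c, V (a ⊗ₜ (b ⊗ₜ c)) =
      ∑ i, (c * Module.finBasis k H i * a) ⊗ₜ[k] (algDual k H (dualVec k H i) * algH k H b) := by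
    intro a b c
    simp [V]
  let m : H ⊗[k] H →ₗ[k] H := LinearMap.mul' k H ∘ₗ LinearMap.lTensor H (antipodeInv k H) ∘ₗ
      (TensorProduct.comm k H H).toLinearMap
  have h1 : ∀ t : H ⊗[k] H, LinearMap.lTensor H (algH k H).toLinearMap (TensorProduct.comm k H H t) *
      univ (algDual k H) = V (LinearMap.lTensor H (LinearMap.lTensor H m)
        (LinearMap.lTensor H (TensorProduct.assoc k H H H).toLinearMap
        (TensorProduct.assoc k H (H ⊗[k] H) H (LinearMap.rTensor H comul₃ t)))) := by
    intro t
    induction t with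
    | zero => simp
    | add s t hs ht => simp only [map_add, hs, ht, add_mul]
    | tmul x y =>
      simp only [TensorProduct.comm_tmul, LinearMap.lTensor_tmul, univ, Finset.mul_sum,
        Algebra.TensorProduct.tmul_mul_tmul, AlgHom.toLinearMap_apply, algH_mul_algDual,
        LinearMap.rTensor_tmul, straighten, LinearMap.comp_apply]
      generalize comul₃ (k := k) x = s
      induction s with
      | zero => simp
      | add s t hs ht =>
        simp only [map_add, LinearMap.add_apply, TensorProduct.tmul_add, TensorProduct.add_tmul,
          Finset.sum_add_distrib, hs, ht]
      | tmul a s =>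
      induction s with
      | zero => simp
      | add s t hs ht =>
        simp only [map_add, LinearMap.add_apply, TensorProduct.tmul_add, TensorProduct.add_tmul,
          Finset.sum_add_distrib, hs, ht]
      | tmul b c =>
        have h0 := congr(LinearMap.lTensor H (LinearMap.mulRight k (algH k H b) ∘ₗ
          (algDual k H).toLinearMap) $(sum_tmul_precomp (LinearMap.mulLeft k y)
          (LinearMap.mulRight k a ∘ₗ LinearMap.mulLeft k (antipodeInv k H c))))
        simp only [map_sum, LinearMap.lTensor_tmul] at h0
        simp only [straightenAux_tmul, of_tmul, TensorProduct.assoc_tmul, LinearMap.lTensor_tmul,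
          LinearEquiv.coe_coe, hV]
        refine h0.trans ?_
        simp [m, mul_assoc]
  have h2 : m ∘ₗ comul = Algebra.linearMap k H ∘ₗ counit := by
    ext x
    exact mul_antipodeInv_comm_comul k H x
  rw [legComulOp_apply, h1, comul₃_assoc_comul]
  rw [← LinearMap.comp_apply (LinearMap.lTensor H _), ← LinearMap.lTensor_comp,
    ← LinearMap.lTensor_comp, h2, LinearMap.lTensor_comp, LinearMap.lTensor_comp,
    LinearMap.comp_apply, lTensor_lTensor_counit_comul₃, legComul_apply]
  generalize comul (R := k) h = t
  induction t with
  | zero => simp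
  | add s t hs ht => simp only [map_add, hs, ht, mul_add]
  | tmul a b =>
    simp [hV, univ, Finset.sum_mul]

section Lift
variable {B : Type*} [Ring B] [Algebra k B]

/-- The linear map `p ⊗ h ↦ β(p) α(h)` on `D(H)`. -/
noncomputable def liftLinear (α : H →ₐ[k] B) (β : ConvDual k H →ₐ[k] B) :
    DrinfeldDouble k H →ₗ[k] B :=
  LinearMap.mul' k B ∘ₗ TensorProduct.map β.toLinearMap α.toLinearMap ∘ₗ (of k H).symm.toLinearMap

theorem liftLinear_of (α : H →ₐ[k] B) (β : ConvDual k H →ₐ[k] B) (p : ConvDual k H) (h : H) :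
    liftLinear α β (of k H (p ⊗ₜ h)) = β p * α h := by
  simp [liftLinear]

theorem liftLinear_straighten {α : H →ₐ[k] B} {β : ConvDual k H →ₐ[k] B} (hαβ : Exchange α β)
    (h : H) (q : ConvDual k H) :
    liftLinear α β (of k H (straighten k H h q)) = α h * β q := by
  have := ext_dualVec (f := liftLinear α β ∘ₗ (of k H).toLinearMap ∘ₗ straighten k H h)
    (g := LinearMap.mulLeft k (α h) ∘ₗ β.toLinearMap)
    (eq_of_sum_basis_tmul_eq (exchange_iff_sum α β hαβ h))
  exact congr($this q)

/-- The algebra map `D(H) → B` given by algebra maps on `H` and `H^*` satisfying the exchange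
relation. -/
noncomputable def lift (α : H →ₐ[k] B) (β : ConvDual k H →ₐ[k] B) (hαβ : Exchange α β) :
    DrinfeldDouble k H →ₐ[k] B :=
  AlgHom.ofLinearMap (liftLinear α β)
    (by
      change liftLinear α β (of k H (1 ⊗ₜ 1)) = 1
      simp [liftLinear_of])
    fun x y => by
      obtain ⟨x, rfl⟩ := (of k H).surjective x
      obtain ⟨y, rfl⟩ := (of k H).surjective y
      induction x with
      | zero => simp
      | add s t hs ht => simp only [map_add, hs, ht, add_mul]
      | tmul p h =>
      induction y with
      | zero => simp
      | add s t hs ht => simp only [map_add, hs, ht, mul_add]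
      | tmul q g =>
        have h1 : ∀ t, liftLinear α β (of k H (TensorProduct.map (LinearMap.mulLeft k p)
            (LinearMap.mulRight k g) t)) = β p * liftLinear α β (of k H t) * α g := by
          intro t
          induction t with
          | zero => simp
          | add s t hs ht => simp only [map_add, hs, ht, mul_add, add_mul]
          | tmul r f => simp [liftLinear_of, mul_assoc]
        rw [of_mulMap, mulMap_tmul, h1, liftLinear_straighten hαβ, liftLinear_of, liftLinear_of]
        simp only [mul_assoc]

end Lift

end DrinfeldDouble

/-! ### The comultiplication of the double as an algebra map -/

section
variable {B : Type*} [Ring B] [Algebra k B]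

theorem toConv_legComul (α : H →ₐ[k] B) : toConv (legComul α).toLinearMap =
    toConv (Algebra.TensorProduct.includeLeft (R := k) (S := k) (A := H) (B := B)).toLinearMap *
    toConv ((Algebra.TensorProduct.includeRight (R := k) (A := H) (B := B)).comp α).toLinearMap := by
  ext h
  rw [LinearMap.convMul_apply]
  simp only [AlgHom.toLinearMap_apply, legComul_apply]
  generalize comul (R := k) h = t
  induction t with
  | zero => simp
  | tmul a b => simp
  | add s t hs ht => simp only [map_add, hs, ht]

theorem toConv_legComulOp (α : H →ₐ[k] B) : toConv (legComulOp α).toLinearMap =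
    toConv ((Algebra.TensorProduct.includeRight (R := k) (A := H) (B := B)).comp α).toLinearMap *
    toConv (Algebra.TensorProduct.includeLeft (R := k) (S := k) (A := H) (B := B)).toLinearMap := by
  ext h
  rw [LinearMap.convMul_apply]
  simp only [AlgHom.toLinearMap_apply, legComulOp_apply]
  generalize comul (R := k) h = t
  induction t with
  | zero => simp
  | tmul a b => simp
  | add s t hs ht => simp only [map_add, hs, ht]

theorem map_legComul {B' : Type*} [Ring B'] [Algebra k B'] (φ : B →ₐ[k] B') (α : H →ₐ[k] B) (h : H) :
    Algebra.TensorProduct.map (AlgHom.id k H) φ (legComul α h) = legComul (φ.comp α) h := by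
  simp only [legComul_apply]
  generalize comul (R := k) h = t
  induction t with
  | zero => simp
  | tmul a b => simp
  | add s t hs ht => simp only [map_add, hs, ht]

theorem map_legComulOp {B' : Type*} [Ring B'] [Algebra k B'] (φ : B →ₐ[k] B') (α : H →ₐ[k] B)
    (h : H) :
    Algebra.TensorProduct.map (AlgHom.id k H) φ (legComulOp α h) = legComulOp (φ.comp α) h := by
  simp only [legComulOp_apply]
  generalize comul (R := k) h = t
  induction t with
  | zero => simp
  | tmul a b => simp
  | add s t hs ht => simp only [map_add, hs, ht]

theorem Exchange.map {B' : Type*} [Ring B'] [Algebra k B'] (φ : B →ₐ[k] B') {α : H →ₐ[k] B}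
    {β : ConvDual k H →ₐ[k] B} (h : Exchange α β) : Exchange (φ.comp α) (φ.comp β) := by
  intro x
  rw [← map_legComul, ← map_legComulOp, ← map_univ, ← map_mul, ← map_mul, h]

theorem univ_mul_univ (β β' : ConvDual k H →ₐ[k] B) :
    univ β * univ β' = ∑ j, ∑ i, (Module.finBasis k H j * Module.finBasis k H i) ⊗ₜ[k] (β (dualVec k H j) * β' (dualVec k H i)) := by
  simp [univ, Finset.sum_mul_sum]

theorem includeRight_mul_univ {b : B} {β : ConvDual k H →ₐ[k] B} (hb : ∀ p, b * β p = β p * b) :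
    Algebra.TensorProduct.includeRight b * univ β =
      univ β * Algebra.TensorProduct.includeRight b := by
  simp [univ, Finset.sum_mul, Finset.mul_sum, hb]

/-- The universal element corresponds to the identity of `H`, whose convolution inverse is the
antipode. -/
theorem isUnit_univ (β : ConvDual k H →ₐ[k] B) : IsUnit (univ β) := by
  have h1 : univ β * canonMap β (antipode k (A := H)) = 1 := by
    have := canonMap_mul β (toConv LinearMap.id) (toConv (antipode k (A := H)))
    rwa [LinearMap.id_mul_antipode, canonMap_one] at this
  have h2 : canonMap β (antipode k (A := H)) * univ β = 1 := by
    have := canonMap_mul β (toConv (antipode k (A := H))) (toConv LinearMap.id)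
    rwa [LinearMap.antipode_mul_id, canonMap_one] at this
  exact ⟨⟨_, _, h1, h2⟩, rfl⟩

end

namespace DrinfeldDouble

theorem precomp_mulLeft_convMul (p q : ConvDual k H) (y : H) {ι : Type*} (r : Coalgebra.Repr k y ι) :
    precomp (LinearMap.mulLeft k y) (p * q) =
      ∑ i ∈ r.index, precomp (LinearMap.mulLeft k (r.left i)) p *
        precomp (LinearMap.mulLeft k (r.right i)) q := by
  ext x
  simp only [WithConv.ofConv_sum, LinearMap.sum_apply, (ℛ k x).convMul_apply]
  change (p * q).ofConv (y * x) = _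
  rw [LinearMap.convMul_apply, Bialgebra.comul_mul]
  conv_lhs => rw [← r.eq, ← (ℛ k x).eq]
  simp only [Finset.sum_mul_sum, Algebra.TensorProduct.tmul_mul_tmul, map_sum,
    TensorProduct.map_tmul, LinearMap.mul'_apply]
  rfl

/-- For `q ∈ H^*`, the map `y ↦ q(y ?)` with values in `D(H)`. -/
noncomputable def leftTranslates (q : ConvDual k H) : H →ₗ[k] DrinfeldDouble k H :=
  (algDual k H).toLinearMap ∘ₗ (WithConv.linearEquiv k (H →ₗ[k] k)).symm.toLinearMap ∘ₗ
    LinearMap.llcomp k H H k q.ofConv ∘ₗ LinearMap.mul k H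

theorem leftTranslates_apply (q : ConvDual k H) (y : H) :
    leftTranslates q y = algDual k H (precomp (LinearMap.mulLeft k y) q) := rfl

/-- Together with `leftTranslates_one`, this makes the comultiplication of `H^{*cop}` an algebra
map: it is `canonMap` applied to the translates. -/
theorem leftTranslates_mul (p q : ConvDual k H) : toConv (leftTranslates (p * q)) =
    toConv (leftTranslates p) * toConv (leftTranslates q) := by
  ext y
  rw [(ℛ k y).convMul_apply]
  simp only [leftTranslates_apply, precomp_mulLeft_convMul p q y (ℛ k y), map_sum, map_mul]

theorem leftTranslates_one : toConv (leftTranslates (1 : ConvDual k H)) = 1 := by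
  ext y
  have : precomp (LinearMap.mulLeft k y) (1 : ConvDual k H) = counit (R := k) y • 1 := by
    ext x
    change (1 : ConvDual k H).ofConv (y * x) = _
    simp
  simp [leftTranslates_apply, this, Algebra.algebraMap_eq_smul_one]

/-- Expand `y` in the basis in `q(yx)`; the co-opposite order puts the functional of `y` in the
second factor. -/
theorem dualComulCop_eq (q : ConvDual k H) :
    dualComulCop k H q = ∑ j, precomp (LinearMap.mulLeft k (Module.finBasis k H j)) q ⊗ₜ dualVec k H j := by
  have h : (TensorProduct.dualDistribEquiv k H H).symm (q.ofConv ∘ₗ LinearMap.mul' k H) =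
      ∑ j, (Module.finBasis k H).coord j ⊗ₜ (q.ofConv ∘ₗ LinearMap.mulLeft k (Module.finBasis k H j)) := by
    rw [LinearEquiv.symm_apply_eq]
    ext y x
    have h1 : ∀ t, TensorProduct.dualDistribEquiv k H H t = TensorProduct.dualDistrib k H H t :=
      fun t => rfl
    rw [h1]
    simp only [map_sum, TensorProduct.AlgebraTensorModule.curry_apply, TensorProduct.curry_apply,
      LinearMap.coe_restrictScalars, LinearMap.comp_apply, LinearMap.mul'_apply,
      LinearMap.sum_apply, TensorProduct.dualDistrib_apply, Module.Basis.coord_apply,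
      LinearMap.mulLeft_apply]
    conv_lhs => rw [← (Module.finBasis k H).sum_repr y]
    simp only [Finset.sum_mul, map_sum, smul_mul_assoc, map_smul, smul_eq_mul]
  simp only [dualComulCop, LinearMap.comp_apply]
  have h2 : (LinearMap.lcomp k k (LinearMap.mul' k H))
    ((WithConv.linearEquiv k (H →ₗ[k] k)).toLinearMap q) = q.ofConv ∘ₗ LinearMap.mul' k H := rfl
  rw [h2]
  simp only [LinearEquiv.coe_coe]
  rw [h]
  simp only [map_sum, TensorProduct.comm_tmul, TensorProduct.map_tmul]
  rfl

variable (k H) in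
/-- The comultiplication of `H^{*cop}` with values in `D(H) ⊗ D(H)`, as an algebra map. -/
noncomputable def comulDual : ConvDual k H →ₐ[k] DrinfeldDouble k H ⊗[k] DrinfeldDouble k H :=
  AlgHom.ofLinearMap
    (TensorProduct.map (algDual k H).toLinearMap (algDual k H).toLinearMap ∘ₗ dualComulCop k H)
    (by
      have := canonMap_one (A := DrinfeldDouble k H) (algDual k H)
      rw [← leftTranslates_one] at this
      rw [← this]
      simp [dualComulCop_eq, canonMap, leftTranslates_apply])
    (fun p q => by
      have := canonMap_mul (A := DrinfeldDouble k H) (algDual k H) (toConv (leftTranslates p))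
        (toConv (leftTranslates q))
      rw [← leftTranslates_mul] at this
      simpa [dualComulCop_eq, canonMap, leftTranslates_apply] using this.symm)

theorem comulDual_eq (q : ConvDual k H) : comulDual k H q =
    ∑ j, algDual k H (precomp (LinearMap.mulLeft k (Module.finBasis k H j)) q) ⊗ₜ algDual k H (dualVec k H j) := by
  change TensorProduct.map _ _ (dualComulCop k H q) = _
  simp [dualComulCop_eq]

variable (k H) in
/-- The comultiplication of `H` with values in `D(H) ⊗ D(H)`. -/
noncomputable def comulH : H →ₐ[k] DrinfeldDouble k H ⊗[k] DrinfeldDouble k H :=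
  (Algebra.TensorProduct.map (algH k H) (algH k H)).comp (Bialgebra.comulAlgHom k H)

theorem comulH_apply (h : H) : comulH k H h =
  TensorProduct.map (algH k H).toLinearMap (algH k H).toLinearMap (comul h) := rfl

variable (k H) in
/-- The first embedding of `D(H)` in its square. -/
noncomputable abbrev inl : DrinfeldDouble k H →ₐ[k] DrinfeldDouble k H ⊗[k] DrinfeldDouble k H := Algebra.TensorProduct.includeLeft

variable (k H) in
/-- The second embedding of `D(H)` in its square. -/
noncomputable abbrev inr : DrinfeldDouble k H →ₐ[k] DrinfeldDouble k H ⊗[k] DrinfeldDouble k H := Algebra.TensorProduct.includeRight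

/-- This is `(I ⊗ Δ)(R) = R₁₃ R₁₂`. The left translations in `Δ(hₗ^*)`, transposed to the `H` leg,
become the products `hⱼ hₗ`. -/
theorem univ_comulDual : univ (comulDual k H) =
    univ ((inr k H).comp (algDual k H)) * univ ((inl k H).comp (algDual k H)) := by
  have h : ∀ j, ∑ l, Module.finBasis k H l ⊗ₜ[k] (algDual k H (precomp (LinearMap.mulLeft k (Module.finBasis k H j)) (dualVec k H l)) ⊗ₜ[k]
      algDual k H (dualVec k H j)) =
      ∑ l, (Module.finBasis k H j * Module.finBasis k H l) ⊗ₜ[k] (algDual k H (dualVec k H l) ⊗ₜ[k] algDual k H (dualVec k H j)) := by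
    intro j
    have h0 := congr(LinearMap.lTensor H ((TensorProduct.mk k (DrinfeldDouble k H) (DrinfeldDouble k H)).flip (algDual k H (dualVec k H j)) ∘ₗ
      (algDual k H).toLinearMap) $(sum_tmul_precomp (LinearMap.id : H →ₗ[k] H)
      (LinearMap.mulLeft k (Module.finBasis k H j))))
    simpa only [map_sum, LinearMap.lTensor_tmul, LinearMap.comp_apply, LinearMap.id_apply,
      AlgHom.toLinearMap_apply, LinearMap.flip_apply, TensorProduct.mk_apply,
      LinearMap.mulLeft_apply] using h0
  rw [univ_mul_univ, univ]
  simp only [comulDual_eq, TensorProduct.tmul_sum]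
  rw [Finset.sum_comm]
  simp only [h]
  simp

theorem toConv_comulH : toConv (comulH k H).toLinearMap =
    toConv ((inl k H).comp (algH k H)).toLinearMap *
      toConv ((inr k H).comp (algH k H)).toLinearMap := by
  ext h
  rw [LinearMap.convMul_apply]
  simp only [AlgHom.toLinearMap_apply, comulH_apply]
  generalize comul (R := k) h = t
  induction t with
  | zero => simp
  | tmul a b => simp
  | add s t hs ht => simp only [map_add, hs, ht]

/-- Here `R` becomes `R₁₃ R₁₂`, with legs numbered from `H`. The two exchange relations, one for
each copy of the double, move `Δᵒᵖ(h)` past one factor at a time. -/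
theorem exchange_comulH_comulDual : Exchange (comulH k H) (comulDual k H) := by
  let jR : DrinfeldDouble k H ⊗[k] DrinfeldDouble k H →ₐ[k] H ⊗[k] (DrinfeldDouble k H ⊗[k] DrinfeldDouble k H) := Algebra.TensorProduct.includeRight
  let α₁ : H →ₐ[k] DrinfeldDouble k H ⊗[k] DrinfeldDouble k H := (inl k H).comp (algH k H)
  let α₂ : H →ₐ[k] DrinfeldDouble k H ⊗[k] DrinfeldDouble k H := (inr k H).comp (algH k H)
  let β₁ : ConvDual k H →ₐ[k] DrinfeldDouble k H ⊗[k] DrinfeldDouble k H := (inl k H).comp (algDual k H)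
  let β₂ : ConvDual k H →ₐ[k] DrinfeldDouble k H ⊗[k] DrinfeldDouble k H := (inr k H).comp (algDual k H)
  have e₁ : Exchange α₁ β₁ := exchange_algH_algDual.map _
  have e₂ : Exchange α₂ β₂ := exchange_algH_algDual.map _
  let a₁ := toConv (jR.comp α₁).toLinearMap
  let a₂ := toConv (jR.comp α₂).toLinearMap
  let η := toConv (Algebra.TensorProduct.includeLeft (R := k) (S := k) (A := H)
    (B := DrinfeldDouble k H ⊗[k] DrinfeldDouble k H)).toLinearMap
  have ha : toConv (jR.comp (comulH k H)).toLinearMap = a₁ * a₂ := by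
    have := LinearMap.algHom_comp_convMul_distrib (R := k) jR (toConv α₁.toLinearMap)
      (toConv α₂.toLinearMap)
    rw [← toConv_comulH] at this
    exact congrArg toConv this
  -- The three identities `h1`, `h2`, `h3` are bracketings of the convolution products `a₁ * a₂ *
  -- η`, `a₁ * η * a₂` and `η * a₁ * a₂`. They are the start, the middle and the end of the passage
  -- from `Δᵒᵖ` to `Δ`.
  have h1 : toConv (legComulOp (comulH k H)).toLinearMap =
      a₁ * toConv (legComulOp α₂).toLinearMap := by
    rw [toConv_legComulOp, toConv_legComulOp, ← mul_assoc, ← ha]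
  have h2 : a₁ * toConv (legComul α₂).toLinearMap = toConv (legComulOp α₁).toLinearMap * a₂ := by
    rw [toConv_legComulOp, toConv_legComul, ← mul_assoc]
  have h3 : toConv (legComul (comulH k H)).toLinearMap =
      toConv (legComul α₁).toLinearMap * a₂ := by
    rw [toConv_legComul, toConv_legComul, mul_assoc, ← ha]
  have c₁ : ∀ x : H, jR (α₁ x) * univ β₂ = univ β₂ * jR (α₁ x) := by
    intro x
    exact includeRight_mul_univ fun p => by simp [α₁, β₂]
  have c₂ : ∀ x : H, jR (α₂ x) * univ β₁ = univ β₁ * jR (α₂ x) := by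
    intro x
    exact includeRight_mul_univ fun p => by simp [α₂, β₁]
  intro h
  have h1' := congr($(h1) h)
  have h2' := congr($(h2) h)
  have h3' := congr($(h3) h)
  erw [(ℛ k h).convMul_apply] at h1' h3'
  erw [(ℛ k h).convMul_apply, (ℛ k h).convMul_apply] at h2'
  simp only [AlgHom.toLinearMap_apply, a₁, a₂, AlgHom.comp_apply] at h1' h2' h3'
  rw [univ_comulDual, h1', h3']
  calc _ = univ β₂ * (∑ i ∈ (ℛ k h).index, jR (α₁ ((ℛ k h).left i)) *
        legComul α₂ ((ℛ k h).right i)) * univ β₁ := by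
        rw [← mul_assoc]
        congr 1
        rw [Finset.sum_mul, Finset.mul_sum]
        refine Finset.sum_congr rfl fun i _ => ?_
        rw [mul_assoc, e₂, ← mul_assoc, c₁, mul_assoc]
    _ = _ := by
        rw [h2', mul_assoc, mul_assoc]
        congr 1
        rw [Finset.sum_mul, Finset.mul_sum]
        refine Finset.sum_congr rfl fun i _ => ?_
        rw [mul_assoc, c₂, ← mul_assoc, e₁, mul_assoc]

variable (k H) in
/-- The comultiplication of `D(H)` as an algebra map. -/
noncomputable def comulAlg : DrinfeldDouble k H →ₐ[k] DrinfeldDouble k H ⊗[k] DrinfeldDouble k H :=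
  lift (comulH k H) (comulDual k H) exchange_comulH_comulDual

theorem comulAlg_algH (h : H) : comulAlg k H (algH k H h) = comulH k H h := by
  change liftLinear _ _ (of k H (1 ⊗ₜ h)) = _
  simp [liftLinear_of]

theorem comulAlg_algDual (p : ConvDual k H) :
    comulAlg k H (algDual k H p) = comulDual k H p := by
  change liftLinear _ _ (of k H (p ⊗ₜ 1)) = _
  simp [liftLinear_of]

theorem comulD_eq_comulAlg (x : DrinfeldDouble k H) : comulD k H x = comulAlg k H x := by
  induction x using induction_on' with
  | zero => simp
  | add x y hx hy => simp only [map_add, hx, hy]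
  | tmul p h =>
    rw [map_mul (comulAlg k H), comulAlg_algH, comulAlg_algDual, ← of_tmul, comulH_apply]
    change _ = TensorProduct.map _ _ (dualComulCop k H p) * _
    simp only [comulD, LinearMap.comp_apply, LinearEquiv.coe_coe, LinearEquiv.symm_apply_apply,
      TensorProduct.map_tmul]
    generalize dualComulCop k H p = s
    generalize comul (R := k) h = t
    induction s with
    | zero => simp
    | add s s' hs hs' => simp only [TensorProduct.add_tmul, map_add, add_mul, hs, hs']
    | tmul p q =>
    induction t with
    | zero => simp
    | add s s' hs hs' => simp only [TensorProduct.tmul_add, map_add, mul_add, hs, hs']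
    | tmul a b => simp [of_tmul]

end DrinfeldDouble

/-! ### `R` intertwines the comultiplication with its opposite -/

theorem Exchange.sum_legComulOp_mul_univ {B : Type*} [Ring B] [Algebra k B] {α : H →ₐ[k] B}
    {β : ConvDual k H →ₐ[k] B} (e : Exchange α β) {c : Fin (Module.finrank k H) → B}
    (hc : ∀ i p, c i * β p = β p * c i) :
    (∑ i, legComulOp α (Module.finBasis k H i) * Algebra.TensorProduct.includeRight (c i)) * univ β =
      univ β * ∑ i, legComul α (Module.finBasis k H i) * Algebra.TensorProduct.includeRight (c i) := by
  rw [Finset.sum_mul, Finset.mul_sum]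
  refine Finset.sum_congr rfl fun i _ => ?_
  rw [mul_assoc, includeRight_mul_univ (hc i), ← mul_assoc, e, mul_assoc]

namespace DrinfeldDouble

variable (k H) in
/-- The flip of `D(H) ⊗ D(H)` as an algebra automorphism. -/
noncomputable abbrev flip : DrinfeldDouble k H ⊗[k] DrinfeldDouble k H →ₐ[k] DrinfeldDouble k H ⊗[k] DrinfeldDouble k H := (Algebra.TensorProduct.comm k (DrinfeldDouble k H) (DrinfeldDouble k H)).toAlgHom

theorem flip_flip (x : DrinfeldDouble k H ⊗[k] DrinfeldDouble k H) : flip k H (flip k H x) = x :=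
  (Algebra.TensorProduct.comm k (DrinfeldDouble k H) (DrinfeldDouble k H)).symm_apply_apply x

variable (k H) in
/-- The embedding of `H ⊗ D(H)` in `D(H) ⊗ D(H)`. -/
noncomputable abbrev fstH : H ⊗[k] DrinfeldDouble k H →ₐ[k] DrinfeldDouble k H ⊗[k] DrinfeldDouble k H :=
  Algebra.TensorProduct.map (algH k H) (AlgHom.id k (DrinfeldDouble k H))

theorem univR_eq : univR k H = fstH k H (univ (algDual k H)) := by
  simp only [univ, map_sum]
  rfl

theorem fstH_legComul (h : H) : fstH k H (legComul (algH k H) h) = comulH k H h := by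
  rw [legComul_apply, comulH_apply]
  generalize comul (R := k) h = t
  induction t with
  | zero => simp
  | tmul a b => simp
  | add s t hs ht => simp only [map_add, hs, ht]

theorem fstH_legComulOp (h : H) :
    fstH k H (legComulOp (algH k H) h) = flip k H (comulH k H h) := by
  rw [legComulOp_apply, comulH_apply]
  generalize comul (R := k) h = t
  induction t with
  | zero => simp
  | tmul a b => simp
  | add s t hs ht => simp only [map_add, hs, ht]

theorem univR_mul_comulH (h : H) :
    univR k H * comulH k H h = flip k H (comulH k H h) * univR k H := by
  rw [univR_eq, ← fstH_legComulOp, ← fstH_legComul, ← map_mul, ← map_mul,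
    exchange_algH_algDual h]

theorem isUnit_univR : IsUnit (univR k H) := by
  rw [univR_eq]
  exact (isUnit_univ _).map _

theorem univR21R_eq : univR21R k H = flip k H (univR k H) * univR k H := rfl

theorem isUnit_univR21R : IsUnit (univR21R k H) := by
  rw [univR21R_eq]
  exact (isUnit_univR.map _).mul isUnit_univR

/-- `Δ` is the convolution product of the two leg embeddings of `H`, so `canonMap_mul` factors `(Δ ⊗
I)(R)` as `R₁₃ R₂₃`. The opposite order of the embeddings gives `R₂₃ R₁₃` in `sum_legComulOp_mul`.
-/
theorem sum_legComul_mul : ∑ i, legComul ((inl k H).comp (algH k H)) (Module.finBasis k H i) *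
    Algebra.TensorProduct.includeRight ((inr k H) (algDual k H (dualVec k H i))) =
    univ ((inr k H).comp (algDual k H)) * Algebra.TensorProduct.includeRight (univR k H) := by
  let f := toConv (Algebra.TensorProduct.includeLeft (R := k) (S := k) (A := H) (B := DrinfeldDouble k H)).toLinearMap
  let g := toConv ((Algebra.TensorProduct.includeRight (R := k) (A := H) (B := DrinfeldDouble k H)).comp
    (algH k H)).toLinearMap
  have h := congr(Algebra.TensorProduct.assoc k k k H (DrinfeldDouble k H) (DrinfeldDouble k H) $(canonMap_mul (algDual k H) f g))
  rw [← toConv_legComul, map_mul] at h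
  simp only [canonMap, map_sum] at h
  have h1 : ∑ i, Algebra.TensorProduct.assoc k k k H (DrinfeldDouble k H) (DrinfeldDouble k H)
      (f.ofConv (Module.finBasis k H i) ⊗ₜ[k] algDual k H (dualVec k H i)) = univ ((inr k H).comp (algDual k H)) := by
    simp [f, univ]
  have h2 : ∑ i, Algebra.TensorProduct.assoc k k k H (DrinfeldDouble k H) (DrinfeldDouble k H)
      (g.ofConv (Module.finBasis k H i) ⊗ₜ[k] algDual k H (dualVec k H i)) =
      Algebra.TensorProduct.includeRight (univR k H) := by
    simp only [univR_eq, univ, map_sum]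
    simp [g]
  rw [h1, h2] at h
  rw [h]
  refine Finset.sum_congr rfl fun i _ => ?_
  simp only [AlgHom.toLinearMap_apply, legComul_apply]
  generalize comul (R := k) (Module.finBasis k H i) = t
  induction t with
  | zero => simp
  | tmul a b => simp
  | add s t hs ht => simp only [map_add, add_mul, TensorProduct.add_tmul, hs, ht]

theorem sum_legComulOp_mul : ∑ i, legComulOp ((inl k H).comp (algH k H)) (Module.finBasis k H i) *
    Algebra.TensorProduct.includeRight ((inr k H) (algDual k H (dualVec k H i))) =
    Algebra.TensorProduct.includeRight (univR k H) * univ ((inr k H).comp (algDual k H)) := by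
  let f := toConv (Algebra.TensorProduct.includeLeft (R := k) (S := k) (A := H) (B := DrinfeldDouble k H)).toLinearMap
  let g := toConv ((Algebra.TensorProduct.includeRight (R := k) (A := H) (B := DrinfeldDouble k H)).comp
    (algH k H)).toLinearMap
  have h := congr(Algebra.TensorProduct.assoc k k k H (DrinfeldDouble k H) (DrinfeldDouble k H) $(canonMap_mul (algDual k H) g f))
  rw [← toConv_legComulOp, map_mul] at h
  simp only [canonMap, map_sum] at h
  have h1 : ∑ i, Algebra.TensorProduct.assoc k k k H (DrinfeldDouble k H) (DrinfeldDouble k H)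
      (f.ofConv (Module.finBasis k H i) ⊗ₜ[k] algDual k H (dualVec k H i)) = univ ((inr k H).comp (algDual k H)) := by
    simp [f, univ]
  have h2 : ∑ i, Algebra.TensorProduct.assoc k k k H (DrinfeldDouble k H) (DrinfeldDouble k H)
      (g.ofConv (Module.finBasis k H i) ⊗ₜ[k] algDual k H (dualVec k H i)) =
      Algebra.TensorProduct.includeRight (univR k H) := by
    simp only [univR_eq, univ, map_sum]
    simp [g]
  rw [h1, h2] at h
  rw [h]
  refine Finset.sum_congr rfl fun i _ => ?_
  simp only [AlgHom.toLinearMap_apply, legComulOp_apply]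
  generalize comul (R := k) (Module.finBasis k H i) = t
  induction t with
  | zero => simp
  | tmul a b => simp
  | add s t hs ht => simp only [map_add, add_mul, TensorProduct.add_tmul, hs, ht]

theorem univ_flip_comulDual : univ ((flip k H).comp (comulDual k H)) =
    univ ((inl k H).comp (algDual k H)) * univ ((inr k H).comp (algDual k H)) := by
  have h1 : (flip k H).comp (inl k H) = inr k H := by ext; simp
  have h2 : (flip k H).comp (inr k H) = inl k H := by ext; simp
  rw [← map_univ, univ_comulDual, map_mul, map_univ, map_univ, ← AlgHom.comp_assoc,
    ← AlgHom.comp_assoc, h1, h2]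

theorem includeRight_mul_univ_eq {B : Type*} [Ring B] [Algebra k B] (b : B)
    (β : ConvDual k H →ₐ[k] B) :
    Algebra.TensorProduct.includeRight b * univ β = ∑ i, Module.finBasis k H i ⊗ₜ[k] (b * β (dualVec k H i)) := by
  simp [univ, Finset.mul_sum]

theorem univ_mul_includeRight_eq {B : Type*} [Ring B] [Algebra k B] (b : B)
    (β : ConvDual k H →ₐ[k] B) :
    univ β * Algebra.TensorProduct.includeRight b = ∑ i, Module.finBasis k H i ⊗ₜ[k] (β (dualVec k H i) * b) := by
  simp [univ, Finset.sum_mul]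

/-- Taken for all `q` at once, this is the Yang–Baxter equation `R₂₃ R₁₃ R₁₂ = R₁₂ R₁₃ R₂₃` in `H ⊗
D(H) ⊗ D(H)`. It follows from the exchange relation on the first two legs, summed against `hᵢ^*` in
the third. -/
theorem univR_mul_comulDual (q : ConvDual k H) :
    univR k H * comulDual k H q = flip k H (comulDual k H q) * univR k H := by
  let jR : DrinfeldDouble k H ⊗[k] DrinfeldDouble k H →ₐ[k] H ⊗[k] (DrinfeldDouble k H ⊗[k] DrinfeldDouble k H) := Algebra.TensorProduct.includeRight
  have e : Exchange ((inl k H).comp (algH k H)) ((inl k H).comp (algDual k H)) :=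
    exchange_algH_algDual.map _
  have key : jR (univR k H) * univ (comulDual k H) =
      univ ((flip k H).comp (comulDual k H)) * jR (univR k H) := by
    have h := e.sum_legComulOp_mul_univ (c := fun i => inr k H (algDual k H (dualVec k H i)))
      fun i p => by simp
    rw [sum_legComulOp_mul, sum_legComul_mul] at h
    rw [univ_comulDual, univ_flip_comulDual]
    exact ((mul_assoc _ _ _).symm.trans h).trans (mul_assoc _ _ _).symm
  simp only [jR] at key
  rw [includeRight_mul_univ_eq, univ_mul_includeRight_eq] at key
  have := ext_dualVec (f := LinearMap.mulLeft k (univR k H) ∘ₗ (comulDual k H).toLinearMap)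
    (g := LinearMap.mulRight k (univR k H) ∘ₗ ((flip k H).comp (comulDual k H)).toLinearMap)
    (eq_of_sum_basis_tmul_eq key)
  exact congr($this q)

theorem univR_mul_comulAlg (x : DrinfeldDouble k H) :
    univR k H * comulAlg k H x = flip k H (comulAlg k H x) * univR k H := by
  induction x using induction_on' with
  | zero => simp
  | add x y hx hy => simp only [map_add, mul_add, add_mul, hx, hy]
  | tmul p h =>
    rw [map_mul (comulAlg k H), comulAlg_algH, comulAlg_algDual, ← mul_assoc, univR_mul_comulDual,
      mul_assoc, univR_mul_comulH, ← mul_assoc, ← map_mul]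

theorem comulAlg_mul_flip_univR (x : DrinfeldDouble k H) :
    comulAlg k H x * flip k H (univR k H) =
      flip k H (univR k H) * flip k H (comulAlg k H x) := by
  rw [← map_mul, univR_mul_comulAlg, map_mul, flip_flip]

/-- `R` turns `Δ` into `Δᵒᵖ` and `R₂₁` turns it back. -/
theorem commute_univR21R_comulAlg (x : DrinfeldDouble k H) : Commute (univR21R k H) (comulAlg k H x) := by
  change _ * _ = _ * _
  rw [univR21R_eq, mul_assoc, univR_mul_comulAlg, ← mul_assoc, ← mul_assoc,
    comulAlg_mul_flip_univR]

/-! ### The Drinfeld element: its coproduct and its commutation with `H^*` -/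

theorem antipodeD_inclDual (p : ConvDual k H) :
    antipodeD k H (inclDual k H p) = inclDual k H (precomp (antipodeInv k H) p) := by
  simp only [inclDual_apply, antipodeD, LinearMap.comp_apply, LinearEquiv.coe_coe,
    LinearEquiv.symm_apply_apply, TensorProduct.comm_tmul, TensorProduct.map_tmul, antipode_one,
    LinearMap.mul'_apply]
  exact one_mul _

theorem drinfeldElement_eq : drinfeldElement k H =
    contr (algDual k H) ((algH k H).toLinearMap ∘ₗ antipodeInv k H) := by
  rw [contr_comp, drinfeldElement, univR]
  simp only [map_sum, TensorProduct.comm_tmul, LinearMap.rTensor_tmul, antipodeD_inclDual,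
    LinearMap.mul'_apply]
  rfl

theorem sum_mul_univR_mul_comulH : ∑ i, inr k H (algDual k H (dualVec k H i)) *
    (univR k H * comulH k H (antipodeInv k H (Module.finBasis k H i))) = inr k H (drinfeldElement k H) := by
  have h := congr(fstH k H $(contr_univ_mul_legComul (algH k H) (algDual k H)))
  rw [← drinfeldElement_eq, map_sum] at h
  simp only [map_mul, ← univR_eq, fstH_legComul] at h
  simpa using h

theorem sum_mul_comulH_mul_flip : ∑ i, inl k H (algDual k H (dualVec k H i)) *
    (comulH k H (antipodeInv k H (Module.finBasis k H i)) * flip k H (univR k H)) =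
    inl k H (drinfeldElement k H) := by
  have h := congr(flip k H $(sum_mul_univR_mul_comulH (k := k) (H := H)))
  rw [map_sum] at h
  simp only [map_mul, ← comulAlg_algH] at h
  simp only [← comulAlg_mul_flip_univR] at h
  simpa [comulAlg_algH] using h

/-- Apply `Δ ∘ S⁻¹` to the `H` leg of `univ_comulDual` and multiply the legs. As `S⁻¹` reverses `hⱼ
hᵢ`, the sum over `i` is nested inside the sum over `j`. -/
theorem comulAlg_drinfeldElement : comulAlg k H (drinfeldElement k H) =
    ∑ j, inr k H (algDual k H (dualVec k H j)) * (∑ i, inl k H (algDual k H (dualVec k H i)) *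
      comulH k H (antipodeInv k H (Module.finBasis k H i))) * comulH k H (antipodeInv k H (Module.finBasis k H j)) := by
  have e1 : (comulAlg k H).comp (algDual k H) = comulDual k H := AlgHom.ext comulAlg_algDual
  have e2 : (comulAlg k H).toLinearMap ∘ₗ (algH k H).toLinearMap ∘ₗ antipodeInv k H =
    (comulH k H).toLinearMap ∘ₗ antipodeInv k H := by
    ext x
    exact comulAlg_algH _
  rw [drinfeldElement_eq, map_contr, e1, e2]
  have h := congr(LinearMap.mul' k _ (TensorProduct.comm k _ _ (LinearMap.rTensor _
    ((comulH k H).toLinearMap ∘ₗ antipodeInv k H) $(univ_comulDual (k := k) (H := H)))))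
  rw [univ_mul_univ, univ] at h
  simp only [map_sum, LinearMap.rTensor_tmul, TensorProduct.comm_tmul, LinearMap.mul'_apply,
    LinearMap.comp_apply, AlgHom.toLinearMap_apply, antipodeInv_mul, map_mul] at h
  refine h.trans ?_
  simp only [Finset.mul_sum, Finset.sum_mul, mul_assoc]
  rfl

/-- Since `Q` commutes with `Δ`, it can be inserted between the two coproduct factors as `R₂₁`
followed by `R`. The inner sum absorbs `R₂₁` and becomes `u ⊗ 1`; the outer one absorbs `R` and
becomes `1 ⊗ u`. -/
theorem comulAlg_drinfeldElement_mul : comulAlg k H (drinfeldElement k H) * univR21R k H =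
    drinfeldElement k H ⊗ₜ drinfeldElement k H := by
  have h1 : ∀ x, comulH k H x * univR21R k H =
      flip k H (univR k H) * (univR k H * comulH k H x) := by
    intro x
    rw [← comulAlg_algH, ← (commute_univR21R_comulAlg _).eq, univR21R_eq, mul_assoc]
  have h2 : ∀ q : ConvDual k H, inr k H (algDual k H q) * inl k H (drinfeldElement k H) =
      inl k H (drinfeldElement k H) * inr k H (algDual k H q) := by
    intro q
    simp
  rw [comulAlg_drinfeldElement, Finset.sum_mul]
  calc _ = ∑ j, inl k H (drinfeldElement k H) * (inr k H (algDual k H (dualVec k H j)) *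
        (univR k H * comulH k H (antipodeInv k H (Module.finBasis k H j)))) := by
        refine Finset.sum_congr rfl fun j _ => ?_
        rw [mul_assoc, h1, mul_assoc, ← mul_assoc (∑ i, _), ← mul_assoc (inl k H _), ← h2,
          mul_assoc (inr k H _)]
        congr 2
        rw [← sum_mul_comulH_mul_flip, Finset.sum_mul]
        simp only [mul_assoc]
    _ = _ := by
      rw [← Finset.mul_sum, sum_mul_univR_mul_comulH]
      simp

/-- In `H ⊗ D(H)`, `contr_univ_mul_legComul` and the exchange relation give `T (1 ⊗ u) R = 1 ⊗ u`,
where `T` is the tensor of `S⁻¹`. The tensor of `S⁻²` is a left inverse of `T`, so `(1 ⊗ u) R`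
equals it times `1 ⊗ u`; the coefficients of the `hᵢ` give the claim. -/
theorem drinfeldElement_mul_algDual (q : ConvDual k H) :
    drinfeldElement k H * algDual k H q =
      algDual k H (precomp (antipodeInv k H ∘ₗ antipodeInv k H) q) * drinfeldElement k H := by
  let jR : DrinfeldDouble k H →ₐ[k] H ⊗[k] DrinfeldDouble k H := Algebra.TensorProduct.includeRight
  let F : H →ₗ[k] H →ₗ[k] H ⊗[k] DrinfeldDouble k H :=
    (TensorProduct.mk k H (DrinfeldDouble k H)).compl₁₂ (antipodeInv k H) ((algH k H).toLinearMap ∘ₗ antipodeInv k H)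
  have h1 := contr_contr (jR.comp (algDual k H)) F
  have h2 : TensorProduct.lift F ∘ₗ comul =
      (legComulOp (algH k H)).toLinearMap ∘ₗ antipodeInv k H := by
    ext x
    simp only [LinearMap.comp_apply, AlgHom.toLinearMap_apply, legComulOp_apply, comul_antipodeInv]
    generalize comul (R := k) x = t
    induction t with
    | zero => simp
    | tmul a b => simp [F]
    | add s t hs ht => simp only [map_add, hs, ht]
  have h3 : ∀ x, contr (jR.comp (algDual k H)) (F x) =
      antipodeInv k H x ⊗ₜ drinfeldElement k H := by
    intro x
    simp only [drinfeldElement_eq, contr, TensorProduct.tmul_sum]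
    refine Finset.sum_congr rfl fun i _ => ?_
    simp [jR, F]
  have h4 := contr_univ_mul_legComul (algH k H) (algDual k H)
  simp only [← exchange_algH_algDual _, ← mul_assoc] at h4
  rw [← Finset.sum_mul, ← drinfeldElement_eq] at h4
  have h5 : ∑ i, (1 ⊗ₜ algDual k H (dualVec k H i)) * legComulOp (algH k H) (antipodeInv k H (Module.finBasis k H i)) =
      canonMap (algDual k H) (antipodeInv k H) * jR (drinfeldElement k H) := by
    rw [h2] at h1
    refine h1.symm.trans ?_
    simp only [h3, canonMap, Finset.sum_mul]
    refine Finset.sum_congr rfl fun i _ => ?_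
    simp [jR]
  rw [h5] at h4
  have h6 : canonMap (algDual k H) (antipodeInv k H ∘ₗ antipodeInv k H) *
      canonMap (algDual k H) (antipodeInv k H) = 1 := by
    have := canonMap_mul (algDual k H) (toConv (antipodeInv k H ∘ₗ antipodeInv k H))
      (toConv (antipodeInv k H))
    refine this.trans ?_
    rw [← canonMap_one (A := H) (algDual k H)]
    congr 2
    ext x
    rw [LinearMap.convMul_apply, LinearMap.convOne_apply, ← counit_antipodeInv (k := k) x,
      ← mul_rTensor_antipodeInv_comm_comul, comul_antipodeInv]
    generalize comul (R := k) x = t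
    induction t with
    | zero => simp
    | tmul a b => simp
    | add s t hs ht => simp only [map_add, hs, ht]
  have h7 : jR (drinfeldElement k H) * univ (algDual k H) =
      canonMap (algDual k H) (antipodeInv k H ∘ₗ antipodeInv k H) * jR (drinfeldElement k H) := by
    have := congr(canonMap (algDual k H) (antipodeInv k H ∘ₗ antipodeInv k H) * $h4)
    rw [← mul_assoc, ← mul_assoc, h6, one_mul] at this
    exact this
  have h8 : canonMap (algDual k H) (antipodeInv k H ∘ₗ antipodeInv k H) *
      jR (drinfeldElement k H) = ∑ i, Module.finBasis k H i ⊗ₜ[k] (algDual k H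
        (precomp (antipodeInv k H ∘ₗ antipodeInv k H) (dualVec k H i)) * drinfeldElement k H) := by
    have h0 := congr(LinearMap.lTensor H (LinearMap.mulRight k (drinfeldElement k H) ∘ₗ
      (algDual k H).toLinearMap) $(sum_tmul_precomp (LinearMap.id : H →ₗ[k] H)
      (antipodeInv k H ∘ₗ antipodeInv k H)))
    simp only [map_sum, LinearMap.lTensor_tmul] at h0
    refine Eq.trans ?_ h0.symm
    simp [canonMap, Finset.sum_mul, jR]
  rw [h8, includeRight_mul_univ_eq] at h7
  have := ext_dualVec (f := LinearMap.mulLeft k (drinfeldElement k H) ∘ₗ (algDual k H).toLinearMap)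
    (g := LinearMap.mulRight k (drinfeldElement k H) ∘ₗ (algDual k H).toLinearMap ∘ₗ
      precomp (antipodeInv k H ∘ₗ antipodeInv k H))
    (eq_of_sum_basis_tmul_eq h7)
  exact congr($this q)

end DrinfeldDouble

theorem leastPos_congr {P Q : ℕ → Prop} (h : ∀ n, 0 < n → (P n ↔ Q n)) : leastPos P = leastPos Q := by
  have : {n | 0 < n ∧ P n} = {n | 0 < n ∧ Q n} := by
    ext n
    exact and_congr_right (h n)
  rw [leastPos, leastPos, this]

/-! ### Twisted powers as convolution products -/

section TwistedPower

theorem iterMul_map_mulEquiv (n : ℕ) (f : Fin (n + 1) → H →ₗ[k] H) :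
    (iterMul k H (n + 1) ∘ₗ PiTensorProduct.map f) ∘ₗ
      (TensorPower.mulEquiv (R := k) (M := H)).toLinearMap =
    LinearMap.mul' k H ∘ₗ TensorProduct.map
      (iterMul k H n ∘ₗ PiTensorProduct.map fun i => f i.castSucc)
      (f (Fin.last n) ∘ₗ
        (PiTensorProduct.subsingletonEquiv (R := k) (s := fun _ : Fin 1 => H) 0).toLinearMap) := by
  apply TensorProduct.ext
  ext a b
  simp only [LinearMap.compMultilinearMap_apply, LinearMap.compr₂ₛₗ_apply, LinearMap.comp_apply, TensorProduct.mk_apply, TensorProduct.map_tmul, LinearMap.mul'_apply,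
    LinearEquiv.coe_coe]
  have h := TensorPower.tprod_mul_tprod k a b
  rw [TensorPower.gMul_def] at h
  rw [h, PiTensorProduct.subsingletonEquiv_apply_tprod]
  simp only [iterMul, PiTensorProduct.map_tprod, PiTensorProduct.lift.tprod,
    MultilinearMap.mkPiAlgebraFin_apply]
  rw [List.ofFn_succ', List.concat_eq_append, List.prod_append]
  have h1 : ∀ i : Fin n, Fin.append a b i.castSucc = a i := fun i => Fin.append_left a b i
  have h2 : Fin.append a b (Fin.last n) = b 0 := Fin.append_right a b 0
  simp [h1, h2]

theorem twistedPower_zero : toConv (twistedPower k H 0) = 1 := by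
  ext x
  simp [twistedPower, iterComul, iterMul, TensorPower.algebraMap₀_eq_smul_one,
    TensorPower.gOne_def, Algebra.algebraMap_eq_smul_one]

theorem twistedPower_succ (n : ℕ) : toConv (twistedPower k H (n + 1)) =
    toConv (twistedPower k H n) *
      toConv ((antipodeInv k H : Module.End k H) ^ (2 * n)) := by
  ext x
  rw [LinearMap.convMul_apply]
  have h := iterMul_map_mulEquiv n
    (fun i : Fin (n + 1) => (antipodeInv k H : Module.End k H) ^ (2 * (i : ℕ)))
  change (iterMul k H (n + 1) ∘ₗ PiTensorProduct.map (fun i : Fin (n + 1) =>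
    (antipodeInv k H : Module.End k H) ^ (2 * (i : ℕ)))) ((TensorPower.mulEquiv (R := k)
    (M := H)).toLinearMap _) = _
  rw [← LinearMap.comp_apply, h]
  simp only [LinearMap.comp_apply]
  generalize comul (R := k) x = t
  induction t with
  | zero => simp
  | tmul a b => simp [twistedPower]
  | add s t hs ht => simp only [map_add, hs, ht]

variable (k H) in
/-- The inverse square of the antipode. -/
noncomputable abbrev antipodeInvSq : H →ₗ[k] H := antipodeInv k H ∘ₗ antipodeInv k H

theorem comul_antipodeInvSq (x : H) : comul (R := k) (antipodeInvSq k H x) =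
    TensorProduct.map (antipodeInvSq k H) (antipodeInvSq k H) (comul x) := by
  simp only [LinearMap.comp_apply, comul_antipodeInv]
  generalize comul (R := k) x = t
  induction t with
  | zero => simp
  | tmul a b => simp
  | add s t hs ht => simp only [map_add, hs, ht]

theorem convMul_comp_antipodeInvSq (f g : WithConv (H →ₗ[k] H)) :
    toConv ((f * g).ofConv ∘ₗ antipodeInvSq k H) =
      toConv (f.ofConv ∘ₗ antipodeInvSq k H) * toConv (g.ofConv ∘ₗ antipodeInvSq k H) := by
  ext x
  rw [LinearMap.convMul_apply]
  change (f * g).ofConv (antipodeInvSq k H x) = _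
  rw [LinearMap.convMul_apply, comul_antipodeInvSq]
  generalize comul (R := k) x = t
  induction t with
  | zero => simp
  | tmul a b => simp
  | add s t hs ht => simp only [map_add, hs, ht]

theorem antipodeInv_pow_succ (n : ℕ) : (antipodeInv k H : Module.End k H) ^ (2 * (n + 1)) =
    ((antipodeInv k H : Module.End k H) ^ (2 * n)) ∘ₗ antipodeInvSq k H := by
  rw [mul_add, pow_add, mul_one, pow_two]
  rfl

/-- The recursion from the left end: `S⁻²` is a coalgebra map, so precomposition with it respects
convolution and shifts every exponent by one step. This is the form matching left multiplication by
`u`. -/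
theorem twistedPower_succ' (n : ℕ) : toConv (twistedPower k H (n + 1)) =
    toConv LinearMap.id * toConv (twistedPower k H n ∘ₗ antipodeInvSq k H) := by
  induction n with
  | zero =>
    have h : toConv (twistedPower k H 0 ∘ₗ antipodeInvSq k H) = 1 := by
      ext x
      have := congr($(twistedPower_zero (k := k) (H := H)) (antipodeInvSq k H x))
      rw [LinearMap.convOne_apply] at this ⊢
      refine this.trans ?_
      simp [counit_antipodeInv]
    rw [twistedPower_succ, h, twistedPower_zero, mul_one, one_mul, mul_zero, pow_zero]
    rfl
  | succ n ih =>
    rw [twistedPower_succ (n + 1), ih, antipodeInv_pow_succ, mul_assoc]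
    congr 1
    have := convMul_comp_antipodeInvSq (toConv (twistedPower k H n))
      (toConv ((antipodeInv k H : Module.End k H) ^ (2 * n)))
    rw [← twistedPower_succ] at this
    exact this.symm

theorem twistedPower_succ_apply (n : ℕ) (x : H) : twistedPower k H (n + 1) x =
    LinearMap.mul' k H (TensorProduct.map (twistedPower k H n)
      ((antipodeInv k H : Module.End k H) ^ (2 * n)) (comul x)) := by
  have h := congr($(twistedPower_succ (k := k) (H := H) n) x)
  rwa [LinearMap.convMul_apply] at h

theorem twistedPower_zero_apply (x : H) :
    twistedPower k H 0 x = algebraMap k H (counit (R := k) x) := by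
  have h := congr($(twistedPower_zero (k := k) (H := H)) x)
  rwa [LinearMap.convOne_apply] at h

theorem antipodeInv_pow_two_mul_apply {h : H} (hh : antipodeInvSq k H h = h) (n : ℕ) :
    ((antipodeInv k H : Module.End k H) ^ (2 * n)) h = h := by
  induction n with
  | zero => simp
  | succ n ih => rw [antipodeInv_pow_succ, LinearMap.comp_apply, hh, ih]

theorem twistedPower_of_comul_eq {h : H} (hc : comul (R := k) h = h ⊗ₜ h)
    (he : counit (R := k) h = 1) (hh : antipodeInvSq k H h = h) (n : ℕ) :
    twistedPower k H n h = h ^ n := by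
  induction n with
  | zero => simp [twistedPower_zero_apply, he]
  | succ n ih =>
    rw [twistedPower_succ_apply, hc, TensorProduct.map_tmul, LinearMap.mul'_apply, ih,
      antipodeInv_pow_two_mul_apply hh, pow_succ]

theorem twistedPower_one (n : ℕ) : twistedPower k H n 1 = 1 := by
  rw [twistedPower_of_comul_eq, one_pow]
  · simp [Algebra.TensorProduct.one_def]
  · simp
  · simp [antipodeInv_one]

/-- A character invariant under `S⁻²` sends each factor of the twisted power to `p` itself. -/
theorem algHom_comp_twistedPower {p : H →ₐ[k] k}
    (hp : p.toLinearMap ∘ₗ antipodeInvSq k H = p.toLinearMap) (n : ℕ) :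
    toConv (p.toLinearMap ∘ₗ twistedPower k H n) = toConv p.toLinearMap ^ n := by
  have hp' : ∀ n, p.toLinearMap ∘ₗ ((antipodeInv k H : Module.End k H) ^ (2 * n)) =
      p.toLinearMap := by
    intro n
    induction n with
    | zero => rfl
    | succ n ih => rw [antipodeInv_pow_succ, ← LinearMap.comp_assoc, ih, hp]
  induction n with
  | zero =>
    ext x
    simp [twistedPower_zero_apply]
  | succ n ih =>
    have := LinearMap.algHom_comp_convMul_distrib (R := k) p (toConv (twistedPower k H n))
      (toConv ((antipodeInv k H : Module.End k H) ^ (2 * n)))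
    rw [← twistedPower_succ] at this
    refine (congrArg toConv this).trans ?_
    rw [pow_succ, ← ih]
    exact congrArg (toConv _ * toConv ·) (hp' n)

theorem counit_antipodeInv_comp : (Bialgebra.counitAlgHom k H).toLinearMap ∘ₗ antipodeInvSq k H =
    (Bialgebra.counitAlgHom k H).toLinearMap := by
  ext x
  simp [counit_antipodeInv]

theorem counit_twistedPower (n : ℕ) (x : H) :
    counit (R := k) (twistedPower k H n x) = counit (R := k) x := by
  have h := algHom_comp_twistedPower (counit_antipodeInv_comp (k := k) (H := H)) n
  have h1 : toConv (Bialgebra.counitAlgHom k H).toLinearMap = (1 : ConvDual k H) := by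
    ext x
    simp
  rw [h1, one_pow] at h
  have := congr($h x)
  rw [LinearMap.convOne_apply] at this
  exact this

theorem twistedPower_eq_iff (n : ℕ) : twistedPower k H n = Algebra.linearMap k H ∘ₗ counit ↔
    toConv (twistedPower k H n) = 1 :=
  ⟨fun h => congrArg toConv h, fun h => congrArg ofConv h⟩

end TwistedPower

/-! ### Twisted powers inside the double -/

namespace DrinfeldDouble

/-- The linear map `p ⊗ h ↦ p(a) h` on `D(H)`. -/
noncomputable def evalDual (a : H) : DrinfeldDouble k H →ₗ[k] H :=
  evalSnd H a ∘ₗ (TensorProduct.comm k (ConvDual k H) H).toLinearMap ∘ₗ (of k H).symm.toLinearMap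

theorem evalDual_mul (a : H) (p : ConvDual k H) (h : H) :
    evalDual a (algDual k H p * algH k H h) = p.ofConv a • h := by
  rw [← of_tmul]
  simp [evalDual]

theorem ext_evalDual {x y : DrinfeldDouble k H} (h : ∀ a, evalDual a x = evalDual a y) : x = y := by
  have := ext_evalSnd h
  simpa using this

theorem evalDual_one (a : H) : evalDual a (1 : DrinfeldDouble k H) = algebraMap k H (counit (R := k) a) := by
  have := evalDual_mul a (1 : ConvDual k H) (1 : H)
  rw [map_one, map_one, mul_one] at this
  simpa [Algebra.algebraMap_eq_smul_one] using this

theorem evalDual_algH (a h : H) : evalDual a (algH k H h) = counit (R := k) a • h := by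
  have := evalDual_mul a (1 : ConvDual k H) h
  rw [map_one, one_mul] at this
  rw [this, LinearMap.convOne_apply]
  rfl

theorem algH_injective : Function.Injective (algH k H) := by
  intro x y h
  have := congr(evalDual 1 $h)
  simpa [evalDual_algH] using this

theorem exists_leftInverse_algDual : ∃ e : DrinfeldDouble k H →ₗ[k] ConvDual k H,
    e ∘ₗ (algDual k H).toLinearMap = LinearMap.id := by
  refine ⟨(TensorProduct.rid k _).toLinearMap ∘ₗ LinearMap.lTensor _ counit ∘ₗ
    (of k H).symm.toLinearMap, ?_⟩
  ext1 p
  simp [algDual_apply]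

/-- The embedding of `H^*` has a linear retraction, given by the counit of `H`, so the map is still
injective after tensoring with `A`. -/
theorem canonMap_algDual_injective {A : Type*} [Ring A] [Algebra k A] :
    Function.Injective (canonMap (algDual k H) : (H →ₗ[k] A) → A ⊗[k] DrinfeldDouble k H) := by
  intro f g h
  obtain ⟨e, he⟩ := exists_leftInverse_algDual (k := k) (H := H)
  apply canon_injective
  rw [← lTensor_canon, ← lTensor_canon] at h
  have := congr(LinearMap.lTensor A e $h)
  rwa [← LinearMap.comp_apply, ← LinearMap.comp_apply (LinearMap.lTensor A e),
    ← LinearMap.lTensor_comp, he, LinearMap.lTensor_id] at this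

theorem antipodeD_pow_algDual (m : ℕ) (p : ConvDual k H) :
    ((antipodeD k H : Module.End k (DrinfeldDouble k H)) ^ m) (algDual k H p) =
      algDual k H (precomp ((antipodeInv k H : Module.End k H) ^ m) p) := by
  induction m with
  | zero => rfl
  | succ m ih =>
    rw [pow_succ', Module.End.mul_apply, ih]
    refine (antipodeD_inclDual _).trans ?_
    rfl

theorem lTensor_antipodeD_pow_univR (m : ℕ) :
    ((antipodeD k H : Module.End k (DrinfeldDouble k H)) ^ m).lTensor (DrinfeldDouble k H) (univR k H) =
      canonMap (algDual k H)
        ((algH k H).toLinearMap ∘ₗ ((antipodeInv k H : Module.End k H) ^ m)) := by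
  have h0 := congr(LinearMap.lTensor (DrinfeldDouble k H) (algDual k H).toLinearMap
    $(sum_tmul_precomp (algH k H).toLinearMap ((antipodeInv k H : Module.End k H) ^ m)))
  simp only [map_sum, LinearMap.lTensor_tmul] at h0
  refine Eq.trans ?_ h0
  simp only [univR, map_sum, LinearMap.lTensor_tmul]
  refine Finset.sum_congr rfl fun i _ => ?_
  congr 1
  exact antipodeD_pow_algDual m _

theorem algH_comp_one : (algH k H).toLinearMap ∘ₗ (1 : WithConv (H →ₗ[k] H)).ofConv =
    (1 : WithConv (H →ₗ[k] DrinfeldDouble k H)).ofConv := by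
  ext x
  simp

theorem twistedRProd_eq (n : ℕ) : twistedRProd k H n =
    canonMap (algDual k H) ((algH k H).toLinearMap ∘ₗ twistedPower k H n) := by
  induction n with
  | zero =>
    have h0 : twistedPower k H 0 = (1 : WithConv (H →ₗ[k] H)).ofConv :=
      congrArg ofConv twistedPower_zero
    rw [h0, algH_comp_one, canonMap_one]
    rfl
  | succ n ih =>
    have h1 : twistedRProd k H (n + 1) = twistedRProd k H n *
        ((antipodeD k H : Module.End k (DrinfeldDouble k H)) ^ (2 * n)).lTensor (DrinfeldDouble k H) (univR k H) := by
      simp [twistedRProd, List.range_succ]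
    rw [h1, ih, lTensor_antipodeD_pow_univR]
    have h2 := LinearMap.algHom_comp_convMul_distrib (R := k) (algH k H)
      (toConv (twistedPower k H n)) (toConv ((antipodeInv k H : Module.End k H) ^ (2 * n)))
    rw [← twistedPower_succ] at h2
    refine (canonMap_mul (algDual k H) (toConv _) (toConv _)).trans ?_
    exact congrArg (canonMap (algDual k H)) h2.symm

theorem twistedRProd_eq_one_iff (n : ℕ) :
    twistedRProd k H n = 1 ↔ toConv (twistedPower k H n) = 1 := by
  rw [twistedRProd_eq, ← canonMap_one (A := DrinfeldDouble k H) (algDual k H), canonMap_algDual_injective.eq_iff,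
    ← algH_comp_one]
  constructor
  · intro h
    ext x
    exact algH_injective congr($h x)
  · intro h
    rw [← h]

theorem evalDual_contr (a : H) (g : H →ₗ[k] H) :
    evalDual a (contr (algDual k H) ((algH k H).toLinearMap ∘ₗ g)) = g a := by
  rw [← evalSnd_canon a g, contr, map_sum, canon, map_sum]
  refine Finset.sum_congr rfl fun i _ => ?_
  rw [evalSnd_tmul]
  exact evalDual_mul a _ _

/-- Moving `u` past `hᵢ^*` twists the latter by `S⁻²`, which is then transposed to the argument of
`f`. -/
theorem drinfeldElement_mul_contr (f : H →ₗ[k] DrinfeldDouble k H) : drinfeldElement k H * contr (algDual k H) f =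
    contr (algDual k H) (LinearMap.mulLeft k (drinfeldElement k H) ∘ₗ f ∘ₗ antipodeInvSq k H) := by
  rw [← LinearMap.comp_assoc, contr_comp, contr, Finset.mul_sum]
  refine Finset.sum_congr rfl fun i _ => ?_
  rw [← mul_assoc, drinfeldElement_mul_algDual, mul_assoc]
  rfl

theorem drinfeldElement_pow (n : ℕ) : drinfeldElement k H ^ n =
    contr (algDual k H) ((algH k H).toLinearMap ∘ₗ twistedPower k H n ∘ₗ antipodeInv k H) := by
  induction n with
  | zero =>
    refine ext_evalDual fun a => ?_
    rw [evalDual_contr, LinearMap.comp_apply, twistedPower_zero_apply, pow_zero, evalDual_one,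
      counit_antipodeInv]
  | succ n ih =>
    -- `F x y = S⁻¹(y) · P n (S⁻³ x)`, so `F` on `Δ(x)` is the recursion `twistedPower_succ'` at
    -- `S⁻¹ x`; the flip accounts for `S⁻¹` reversing the coproduct.
    let F : H →ₗ[k] H →ₗ[k] DrinfeldDouble k H := (LinearMap.mul k (DrinfeldDouble k H)).flip.compl₁₂
      ((algH k H).toLinearMap ∘ₗ twistedPower k H n ∘ₗ antipodeInv k H ∘ₗ antipodeInvSq k H)
      ((algH k H).toLinearMap ∘ₗ antipodeInv k H)
    have h1 := contr_contr (algDual k H) F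
    rw [pow_succ', ih, drinfeldElement_mul_contr]
    have h2 : TensorProduct.lift F ∘ₗ comul = (algH k H).toLinearMap ∘ₗ
        twistedPower k H (n + 1) ∘ₗ antipodeInv k H := by
      ext x
      have h3 := congr($(twistedPower_succ' (k := k) (H := H) n) (antipodeInv k H x))
      rw [LinearMap.convMul_apply, comul_antipodeInv] at h3
      simp only [LinearMap.comp_apply]
      rw [h3]
      generalize comul (R := k) x = t
      induction t with
      | zero => simp
      | tmul a b => simp [F]
      | add s t hs ht => simp only [map_add, hs, ht]
    rw [h2] at h1
    refine Eq.trans ?_ h1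
    refine Finset.sum_congr rfl fun i _ => ?_
    congr 1
    simp only [drinfeldElement_eq, contr, LinearMap.comp_apply, LinearMap.mulLeft_apply,
      Finset.sum_mul]
    refine Finset.sum_congr rfl fun j _ => ?_
    simp [F, mul_assoc]

theorem evalDual_drinfeldElement_pow (n : ℕ) (a : H) :
    evalDual a (drinfeldElement k H ^ n) = twistedPower k H n (antipodeInv k H a) := by
  rw [drinfeldElement_pow, evalDual_contr]
  rfl

theorem drinfeldElement_pow_eq_one_iff (n : ℕ) :
    drinfeldElement k H ^ n = 1 ↔ toConv (twistedPower k H n) = 1 := by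
  constructor
  · intro h
    ext x
    have := evalDual_drinfeldElement_pow (k := k) n (antipode k x)
    rw [h, evalDual_one, antipodeInv_antipode, counit_antipode] at this
    rw [LinearMap.convOne_apply]
    exact this.symm
  · intro h
    refine ext_evalDual fun a => ?_
    have := congr($h (antipodeInv k H a))
    rw [LinearMap.convOne_apply, counit_antipodeInv] at this
    rw [evalDual_drinfeldElement_pow, evalDual_one, ← this]

/-! ### Evaluation, coproducts and the order of `R₂₁ R` -/

theorem map_evalDual_comulAlg (a b : H) (x : DrinfeldDouble k H) :
    TensorProduct.map (evalDual a) (evalDual b) (comulAlg k H x) =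
      comul (R := k) (evalDual (b * a) x) := by
  induction x using induction_on' with
  | zero => simp
  | add x y hx hy => simp only [map_add, hx, hy]
  | tmul p h =>
    rw [map_mul (comulAlg k H), comulAlg_algH, comulAlg_algDual, comulDual_eq, evalDual_mul,
      comulH_apply, map_smul]
    generalize comul (R := k) h = t
    induction t with
    | zero => simp
    | add s t hs ht => simp only [map_add, mul_add, smul_add, hs, ht]
    | tmul g f =>
      simp only [TensorProduct.map_tmul, Finset.sum_mul, Algebra.TensorProduct.tmul_mul_tmul,
        map_sum, AlgHom.toLinearMap_apply, evalDual_mul, TensorProduct.smul_tmul_smul]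
      rw [← Finset.sum_smul]
      congr 1
      conv_rhs => rw [← (Module.finBasis k H).sum_repr b]
      simp only [Finset.sum_mul, map_sum, smul_mul_assoc, map_smul, smul_eq_mul]
      refine Finset.sum_congr rfl fun i _ => ?_
      rw [mul_comm]
      rfl

theorem comul_evalDual_mul {x : DrinfeldDouble k H} (hx : comulAlg k H x = x ⊗ₜ x) (a b : H) :
    comul (R := k) (evalDual (b * a) x) = evalDual a x ⊗ₜ evalDual b x := by
  rw [← map_evalDual_comulAlg, hx, TensorProduct.map_tmul]

/-- Evaluating the two legs at `a` and `1` gives `Δ(xₐ) = xₐ ⊗ x₁`, where `xₐ` is the value at `a`;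
apply the counit to the first leg. -/
theorem evalDual_eq_smul {x : DrinfeldDouble k H} (hx : comulAlg k H x = x ⊗ₜ x) (a : H) :
    evalDual a x = counit (R := k) (evalDual a x) • evalDual (1 : H) x := by
  have h := comul_evalDual_mul hx a 1
  rw [one_mul] at h
  have h1 := Coalgebra.rTensor_counit_comul (R := k) (evalDual a x)
  rw [h, LinearMap.rTensor_tmul] at h1
  have h2 := congr(TensorProduct.lid k H $h1)
  simpa using h2.symm

theorem comulAlg_pow_mul {v : DrinfeldDouble k H} (hv : comulAlg k H v * univR21R k H = v ⊗ₜ v) (n : ℕ) :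
    comulAlg k H (v ^ n) * univR21R k H ^ n = (v ^ n) ⊗ₜ (v ^ n) := by
  rw [map_pow, ← (commute_univR21R_comulAlg v).symm.mul_pow, hv, Algebra.TensorProduct.tmul_pow]

/-- Now `Δ(uⁿ) = uⁿ ⊗ uⁿ`, so only the value of `uⁿ` at `1` and the counits of its values matter.
These are `P n 1 = 1` and `ε(P n (S⁻¹ a)) = ε(a)`. -/
theorem drinfeldElement_pow_eq_one {n : ℕ} (h : univR21R k H ^ n = 1) :
    drinfeldElement k H ^ n = 1 := by
  have hx := comulAlg_pow_mul (comulAlg_drinfeldElement_mul (k := k) (H := H)) n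
  rw [h, mul_one] at hx
  refine ext_evalDual fun a => ?_
  rw [evalDual_eq_smul hx, evalDual_drinfeldElement_pow, evalDual_drinfeldElement_pow,
    antipodeInv_one, twistedPower_one, counit_twistedPower, counit_antipodeInv, evalDual_one,
    Algebra.algebraMap_eq_smul_one]

theorem univR21R_pow_eq_one {v : DrinfeldDouble k H} (hv : comulAlg k H v * univR21R k H = v ⊗ₜ v) {n : ℕ}
    (h : v ^ n = 1) : univR21R k H ^ n = 1 := by
  have hx := comulAlg_pow_mul hv n
  rwa [h, map_one, one_mul] at hx

end DrinfeldDouble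

/-! ### Group-like elements and characters -/

section GroupLike

theorem antipodeInv_mul_cancel {h : H} (hc : comul (R := k) h = h ⊗ₜ h)
    (he : counit (R := k) h = 1) : antipodeInv k H h * h = 1 := by
  have := mul_rTensor_antipodeInv_comm_comul (k := k) h
  rw [hc, he, map_one] at this
  simpa using this

theorem mul_antipodeInv_cancel {h : H} (hc : comul (R := k) h = h ⊗ₜ h)
    (he : counit (R := k) h = 1) : h * antipodeInv k H h = 1 := by
  have := mul_antipodeInv_comm_comul k H h
  rw [hc, he, map_one] at this
  simpa using this

theorem antipodeInvSq_of_comul_eq {h : H} (hc : comul (R := k) h = h ⊗ₜ h)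
    (he : counit (R := k) h = 1) : antipodeInvSq k H h = h := by
  have h1 := congr(antipodeInv k H $(mul_antipodeInv_cancel hc he))
  rw [antipodeInv_mul, antipodeInv_one] at h1
  exact left_inv_eq_right_inv h1 (antipodeInv_mul_cancel hc he)

theorem conv_antipodeInv_mul (p : H →ₐ[k] k) :
    toConv (p.toLinearMap ∘ₗ antipodeInv k H) * toConv p.toLinearMap = 1 := by
  ext x
  rw [LinearMap.convMul_apply, LinearMap.convOne_apply, Algebra.algebraMap_self_apply]
  have h := congr(p $(mul_antipodeInv_comm_comul k H x))
  rw [AlgHom.commutes, Algebra.algebraMap_self_apply] at h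
  rw [← h]
  generalize comul (R := k) x = t
  induction t with
  | zero => simp
  | tmul a b => simp [mul_comm]
  | add s t hs ht => simp only [map_add, hs, ht]

/-- As `k` is commutative, `p ∘ S⁻¹` is again a character, and it is the convolution inverse of `p`.
Inverting twice returns `p`. -/
theorem algHom_comp_antipodeInvSq (p : H →ₐ[k] k) :
    p.toLinearMap ∘ₗ antipodeInvSq k H = p.toLinearMap := by
  let p' : H →ₐ[k] k := AlgHom.ofLinearMap (p.toLinearMap ∘ₗ antipodeInv k H)
    (by simp [antipodeInv_one]) (fun x y => by simp [antipodeInv_mul, mul_comm])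
  exact congrArg ofConv (left_inv_eq_right_inv (conv_antipodeInv_mul p') (conv_antipodeInv_mul p))

end GroupLike

namespace DrinfeldDouble

theorem evalDual_add (a b : H) (x : DrinfeldDouble k H) : evalDual (a + b) x = evalDual a x + evalDual b x := by
  induction x using induction_on' with
  | zero => simp
  | add x y hx hy => rw [map_add, map_add, map_add, hx, hy, add_add_add_comm]
  | tmul p h => simp only [evalDual_mul, map_add, add_smul]

theorem evalDual_smul (r : k) (a : H) (x : DrinfeldDouble k H) : evalDual (r • a) x = r • evalDual a x := by
  induction x using induction_on' with
  | zero => simp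
  | add x y hx hy => rw [map_add, map_add, hx, hy, smul_add]
  | tmul p h => simp only [evalDual_mul, map_smul, smul_eq_mul, mul_smul]

/-- The element `h` is the value of `x` at `1`, and `p(a)` is the counit of its value at `a`. By
`evalDual_eq_smul`, `h = 0` would force `x = 0`, and `h ≠ 0` forces `ε(h) = 1`. -/
theorem exists_of_groupLike {x : DrinfeldDouble k H} (hx : comulAlg k H x = x ⊗ₜ x) (h0 : x ≠ 0) :
    ∃ (p : H →ₐ[k] k) (h : H), comul (R := k) h = h ⊗ₜ h ∧ counit (R := k) h = 1 ∧
      x = algDual k H (toConv p.toLinearMap) * algH k H h := by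
  have hc : comul (R := k) (evalDual 1 x : H) = evalDual (1 : H) x ⊗ₜ evalDual (1 : H) x := by
    have := comul_evalDual_mul hx 1 1
    rwa [mul_one] at this
  have hne : evalDual (1 : H) x ≠ 0 := by
    intro h
    refine h0 (ext_evalDual fun a => ?_)
    rw [evalDual_eq_smul hx, h, smul_zero, map_zero]
  have he : counit (R := k) (evalDual (1 : H) x) = 1 := by
    have h := evalDual_eq_smul hx 1
    conv_lhs at h => rw [← one_smul k (evalDual (1 : H) x)]
    exact (smul_left_injective k hne h).symm
  have hm : ∀ a b : H, counit (R := k) (evalDual (b * a) x) =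
      counit (R := k) (evalDual a x) * counit (R := k) (evalDual b x) := by
    intro a b
    have h1 := Coalgebra.rTensor_counit_comul (R := k) (evalDual (b * a) x)
    rw [comul_evalDual_mul hx, LinearMap.rTensor_tmul] at h1
    have h2 := congr(counit (R := k) (TensorProduct.lid k H $h1))
    simpa using h2.symm
  let p : H →ₐ[k] k := AlgHom.ofLinearMap
    { toFun := fun a => counit (R := k) (evalDual a x)
      map_add' := fun a b => by rw [evalDual_add, map_add]
      map_smul' := fun r a => by rw [evalDual_smul, map_smul, RingHom.id_apply] }
    he (fun a b => (hm b a).trans (mul_comm _ _))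
  refine ⟨p, evalDual 1 x, hc, he, ext_evalDual fun a => ?_⟩
  rw [evalDual_mul]
  exact evalDual_eq_smul hx a

theorem commute_drinfeldElement_algDual (p : H →ₐ[k] k) :
    Commute (drinfeldElement k H) (algDual k H (toConv p.toLinearMap)) := by
  have h : precomp (antipodeInv k H ∘ₗ antipodeInv k H) (toConv p.toLinearMap) =
      toConv p.toLinearMap := congrArg toConv (algHom_comp_antipodeInvSq p)
  have := drinfeldElement_mul_algDual (toConv p.toLinearMap)
  rwa [h] at this

theorem algH_mul_algDual_of_comul_eq {h : H} (hc : comul (R := k) h = h ⊗ₜ h)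
    (q : ConvDual k H) : algH k H h * algDual k H q = algDual k H
      (precomp (LinearMap.mulRight k h ∘ₗ LinearMap.mulLeft k (antipodeInv k H h)) q) *
        algH k H h := by
  have h3 : comul₃ (k := k) h = h ⊗ₜ (h ⊗ₜ h) := by
    rw [comul₃, LinearMap.comp_apply, hc, LinearMap.lTensor_tmul, hc]
  rw [algH_mul_algDual, straighten, LinearMap.comp_apply, h3, straightenAux_tmul, of_tmul]
  rfl

/-- Moving `h` past `hᵢ^*` conjugates its argument by `h`. Transposed to the `H` leg, this
conjugation is compatible with `S⁻¹` because `S⁻² h = h`. -/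
theorem commute_drinfeldElement_algH {h : H} (hc : comul (R := k) h = h ⊗ₜ h)
    (he : counit (R := k) h = 1) : Commute (drinfeldElement k H) (algH k H h) := by
  have hs : antipodeInv k H (antipodeInv k H h) = h := antipodeInvSq_of_comul_eq hc he
  let f : H →ₗ[k] DrinfeldDouble k H := LinearMap.mulLeft k (algH k H h) ∘ₗ (algH k H).toLinearMap ∘ₗ antipodeInv k H
  let g : H →ₗ[k] H := LinearMap.mulRight k h ∘ₗ LinearMap.mulLeft k (antipodeInv k H h)
  have h1 : ∀ x, algH k H (antipodeInv k H x) * algH k H h = f (g x) := by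
    intro x
    simp only [f, g, LinearMap.comp_apply, LinearMap.mulLeft_apply, LinearMap.mulRight_apply,
      AlgHom.toLinearMap_apply, ← map_mul, antipodeInv_mul, hs]
    rw [← mul_assoc, mul_antipodeInv_cancel hc he, one_mul]
  have h2 : drinfeldElement k H * algH k H h = contr (algDual k H) (f ∘ₗ g) := by
    rw [drinfeldElement_eq, contr, contr, Finset.sum_mul]
    refine Finset.sum_congr rfl fun i _ => ?_
    rw [mul_assoc]
    exact congrArg _ (h1 _)
  refine h2.trans ?_
  rw [contr_comp, drinfeldElement_eq, contr, Finset.mul_sum]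
  refine Finset.sum_congr rfl fun i _ => ?_
  rw [← mul_assoc, algH_mul_algDual_of_comul_eq hc, mul_assoc]
  rfl

theorem commute_algH_algDual {h : H} (hc : comul (R := k) h = h ⊗ₜ h)
    (he : counit (R := k) h = 1) (p : H →ₐ[k] k) :
    Commute (algDual k H (toConv p.toLinearMap)) (algH k H h) := by
  have h1 : precomp (LinearMap.mulRight k h ∘ₗ LinearMap.mulLeft k (antipodeInv k H h))
      (toConv p.toLinearMap) = toConv p.toLinearMap := by
    ext x
    change p (antipodeInv k H h * x * h) = p x
    have := congr(p $(antipodeInv_mul_cancel hc he))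
    rw [map_mul, map_one] at this
    rw [map_mul, map_mul, mul_right_comm, this, one_mul]
  have := algH_mul_algDual_of_comul_eq hc (toConv p.toLinearMap)
  rw [h1] at this
  exact this.symm

theorem groupLike_pow_eq_one {p : H →ₐ[k] k} {h : H} (hc : comul (R := k) h = h ⊗ₜ h)
    (he : counit (R := k) h = 1) {n : ℕ} (hn : toConv (twistedPower k H n) = 1) :
    (algDual k H (toConv p.toLinearMap) * algH k H h) ^ n = 1 := by
  have h1 : h ^ n = 1 := by
    rw [← twistedPower_of_comul_eq hc he (antipodeInvSq_of_comul_eq hc he)]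
    have := congr($hn h)
    rw [LinearMap.convOne_apply, he, map_one] at this
    exact this
  have h2 : toConv p.toLinearMap ^ n = 1 := by
    rw [← algHom_comp_twistedPower (algHom_comp_antipodeInvSq p)]
    ext x
    have := congr(p ($hn x))
    rw [LinearMap.convOne_apply, AlgHom.commutes] at this
    exact this
  rw [(commute_algH_algDual hc he p).mul_pow, ← map_pow, ← map_pow, h1, h2, map_one, map_one,
    mul_one]

/-- The elements `u` and `v` have the same defect `Q` from being group-like, so their quotient is
group-like. It commutes with `u`, so `v` is a product of two commuting elements whose `n`-th powers
are `1`. -/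
theorem pow_eq_one_of_univR21R_pow_eq_one {v : DrinfeldDouble k H} (h0 : v ≠ 0)
    (hv : comulAlg k H v * univR21R k H = v ⊗ₜ v) {n : ℕ} (hn : 0 < n)
    (hQ : univR21R k H ^ n = 1) : v ^ n = 1 := by
  have hu := drinfeldElement_pow_eq_one hQ
  -- With `n = m + 1` and `uⁿ = 1`, the power `u ^ m` serves as `u⁻¹`; in `hg` the factors `Q ^ m`
  -- from `u ^ m` and `Q` from `v` combine to `Qⁿ = 1`.
  obtain ⟨m, rfl⟩ := Nat.exists_eq_succ_of_ne_zero hn.ne'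
  have hug : drinfeldElement k H * (drinfeldElement k H ^ m * v) = v := by
    rw [← mul_assoc, ← pow_succ', hu, one_mul]
  have hg : comulAlg k H (drinfeldElement k H ^ m * v) =
      (drinfeldElement k H ^ m * v) ⊗ₜ (drinfeldElement k H ^ m * v) := by
    rw [← Algebra.TensorProduct.tmul_mul_tmul, ← hv,
      ← comulAlg_pow_mul comulAlg_drinfeldElement_mul, map_mul, mul_assoc,
      ← (commute_univR21R_comulAlg v).eq, ← mul_assoc (univR21R k H ^ m), ← pow_succ, hQ, one_mul]
  have hg0 : drinfeldElement k H ^ m * v ≠ 0 := by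
    intro h
    rw [h, mul_zero] at hug
    exact h0 hug.symm
  obtain ⟨p, h, hc, he, hph⟩ := exists_of_groupLike hg hg0
  have hcomm : Commute (drinfeldElement k H) (drinfeldElement k H ^ m * v) := by
    rw [hph]
    exact (commute_drinfeldElement_algDual p).mul_right (commute_drinfeldElement_algH hc he)
  rw [← hug, hcomm.mul_pow, hu, one_mul, hph]
  exact groupLike_pow_eq_one hc he ((drinfeldElement_pow_eq_one_iff _).1 hu)

end DrinfeldDouble
end FinHopf

/-! ### The four descriptions of the exponent -/

open FinHopf in
theorem theorem2p5 {k H : Type*} [Field k] [Ring H] [HopfAlgebra k H] [FiniteDimensional k H] :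
    FinHopf.exponent k H =
        FinHopf.leastPos (fun n => FinHopf.DrinfeldDouble.twistedRProd k H n = 1) ∧
    FinHopf.exponent k H = FinHopf.order (FinHopf.DrinfeldDouble.drinfeldElement k H) ∧
    FinHopf.exponent k H = FinHopf.order (FinHopf.DrinfeldDouble.univR21R k H) ∧
    IsUnit (FinHopf.DrinfeldDouble.univR21R k H) ∧
    ∀ v : FinHopf.DrinfeldDouble k H, v ≠ 0 →
      FinHopf.DrinfeldDouble.comulD k H v =
        (v ⊗ₜ[k] v) * Ring.inverse (FinHopf.DrinfeldDouble.univR21R k H) →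
      FinHopf.exponent k H = FinHopf.order v := by
  have hu : ∀ n, DrinfeldDouble.drinfeldElement k H ^ n = 1 ↔
      DrinfeldDouble.univR21R k H ^ n = 1 := fun n =>
    ⟨DrinfeldDouble.univR21R_pow_eq_one DrinfeldDouble.comulAlg_drinfeldElement_mul,
      DrinfeldDouble.drinfeldElement_pow_eq_one⟩
  have hQ : ∀ n, twistedPower k H n = Algebra.linearMap k H ∘ₗ Coalgebra.counit ↔
      DrinfeldDouble.univR21R k H ^ n = 1 := fun n => by
    rw [twistedPower_eq_iff, ← hu, DrinfeldDouble.drinfeldElement_pow_eq_one_iff]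
  refine ⟨?_, ?_, ?_, DrinfeldDouble.isUnit_univR21R, fun v h0 hv => ?_⟩
  · refine leastPos_congr fun n _ => ?_
    rw [twistedPower_eq_iff, DrinfeldDouble.twistedRProd_eq_one_iff]
  · refine leastPos_congr fun n _ => ?_
    rw [hQ, hu]
  · exact leastPos_congr fun n _ => hQ n
  -- `Ring.inverse` is the true inverse here since `Q` is a unit, so `v` satisfies the same relation
  -- as `u`.
  · have hv' : DrinfeldDouble.comulAlg k H v * DrinfeldDouble.univR21R k H = v ⊗ₜ v := by
      rw [← DrinfeldDouble.comulD_eq_comulAlg, hv, mul_assoc,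
        Ring.inverse_mul_cancel _ DrinfeldDouble.isUnit_univR21R, mul_one]
    refine leastPos_congr fun n hn => ?_
    rw [hQ]
    exact ⟨DrinfeldDouble.pow_eq_one_of_univR21R_pow_eq_one h0 hv' hn,
      DrinfeldDouble.univR21R_pow_eq_one hv'⟩
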